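/- **Definitions.** A signature $\Sigma=(\mathcal S,\mathcal C,\mathcal R,\mathrm{ar})$ consists of sorts, constant symbols (each of one sort) and relation symbols $R$ with $\mathrm{ar}(R)\in\mathcal S^*$. Every sort has countably many variables. *FOLTL formulas* over $\Sigma$ are the well-sorted formulas built from $t=t'$ and $R(t_1,\dots,t_k)$ (terms are variables and constants) with $\neg,\vee,\exists x{:}s$, next $\mathsf X$ and until $\mathsf U$, and the derived $\wedge,\forall$ and release, $\phi\,\mathsf R\,\psi:=\neg(\neg\phi\,\mathsf U\,\neg\psi)$. They are interpreted, at time $0$, in *temporal structures*: non-empty universes $(U_s)_{s\in\mathcal S}$ and values of the constants, which do not change over time, and for every $i\in\mathbb N$ an interpretation of the relation symbols. A formula is *satisfiable* if some temporal structure and valuation satisfy it. *BS-FOLTL* consists of the closed FOLTL formulas in negation normal form (with $\wedge,\forall,\mathsf R$ as primitives) whose projection on every sort $s$ (all quantifications over, and all terms of, other sorts are removed) has the form $\exists x_1,\dots,x_k.\,\phi'$ with $k\ge 0$ and no existential quantifier in $\phi'$. Let $\Pi$ be a countably infinite set of trace variables, and let $\Sigma'$ have the sorts and constants of $\Sigma$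 and a relation symbol $R_\pi$ with the arity of $R$ for all $R\in\mathcal R$ and $\pi\in\Pi$. *HyperFOLTL formulas* over $\Sigma$ are given by $\psi::=\exists\pi.\,\psi\mid\neg\psi\mid\phi$ with $\phi$ an FOLTL formula over $\Sigma'$, and $\forall\pi.\,\psi:=\neg\exists\pi.\,\neg\psi$. They are interpreted in a set $\mathcal T$ of temporal structures over $\Sigma$ that share their universes and the values of the constants, with a valuation $\alpha$ of the first-order variables and a valuation $\beta:\Pi\to\mathcal T$ (in particular, $\mathcal T\ne\emptyset$): trace quantifiers range over $\mathcal T$, and $R_\pi$ is interpreted at time $i$ as $R$ is in $\beta(\pi)$ at time $i$. The formula $\psi$ is *satisfiable* if $\mathcal T,\alpha,\beta\models\psi$ for some $\mathcal T,\alpha,\beta$. The fragment $\exists^*_\pi\forall^*_\pi\text{BS-FOLTL}$ consists of the formulas $\exists\pi_1\dots\pi_k.\,\forall\pi'_1\dots\pi'_\ell.\,\phi$ with $k,\ell\ge 0$ and $\phi$ in BS-FOLTL (over $\Sigma'$). The *trace encoding* of a HyperFOLTL formula $\psi$ over $\Sigma$ is the following FOLTL formula $\psi^{T}$ over the signature with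 an additional sort $T$ in which every $R\in\mathcal R$ takes an additional first argument of sort $T$: trace variables are viewed as first-order variables of sort $T$, trace quantifiers $Q\pi$ become $Q\pi{:}T$, and atoms $R_\pi(\bar u)$ become $R(\pi,\bar u)$. **Theorem.** 1. The map $\psi\mapsto\psi^{T}$ is computable, and for every signature $\Sigma$ and every HyperFOLTL formula $\psi$ over $\Sigma$, the formula $\psi$ is satisfiable if and only if the FOLTL formula $\psi^{T}$ is satisfiable. If $\psi$ is closed, then so is $\psi^{T}$. 2. Satisfiability of formulas in $\exists^*_\pi\forall^*_\pi\text{BS-FOLTL}$ is decidable: there is an algorithm that, given a finite signature with at least one sort and a formula of the fragment over it, decides whether the formula is satisfiable. -/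

import Mathlib

namespace FOLTL

/-! ## Many-sorted first-order LTL: signatures and syntax -/

/-- A many-sorted signature with constant and relation symbols and no function symbols. The
symbols of each kind come with a numbering, which is used only to write formulas down as natural
numbers. Finiteness is not built in, because the signature of the formulas that occur inside
HyperFOLTL formulas has a relation symbol `R_π` for every trace variable `π`; see `FinSignature`
for the finite signatures. -/
structure Signature where
  Srt : Type
  Con : Type
  Rel : Type
  [encSrt : Encodable Srt]
  [encCon : Encodable Con]
  [encRel : Encodable Rel]
  conSort : Con → Srt
  arity : Rel → List Srt

attribute [instance] Signature.encSrt Signature.encCon Signature.encRel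

/-- Terms of a given sort: the variables of sort `s` are the pairs `(s, n)` with `n : ℕ`. -/
inductive Term (σ : Signature) : σ.Srt → Type
  | var (s : σ.Srt) (n : ℕ) : Term σ s
  | con (c : σ.Con) : Term σ (σ.conSort c)

/-- Tuples of terms of a given list of sorts. -/
inductive Terms (σ : Signature) : List σ.Srt → Type
  | nil : Terms σ []
  | cons {s : σ.Srt} {l : List σ.Srt} (t : Term σ s) (ts : Terms σ l) : Terms σ (s :: l)

/-- Well-sorted FOLTL formulas. Conjunction, universal quantification and release are primitive,
so that negation normal form makes sense; their semantics is that of the derived operators. -/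
inductive Formula (σ : Signature) : Type
  | eq {s : σ.Srt} (t t' : Term σ s) : Formula σ
  | rel (R : σ.Rel) (ts : Terms σ (σ.arity R)) : Formula σ
  | neg (φ : Formula σ) : Formula σ
  | or (φ ψ : Formula σ) : Formula σ
  | and (φ ψ : Formula σ) : Formula σ
  | ex (s : σ.Srt) (x : ℕ) (φ : Formula σ) : Formula σ
  | all (s : σ.Srt) (x : ℕ) (φ : Formula σ) : Formula σ
  | next (φ : Formula σ) : Formula σ
  | untl (φ ψ : Formula σ) : Formula σ
  | release (φ ψ : Formula σ) : Formula σ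

/-- The free variables of a term. -/
def Term.fv {σ : Signature} {s : σ.Srt} : Term σ s → Set (σ.Srt × ℕ)
  | .var s n => {(s, n)}
  | .con _ => ∅

def Terms.fv {σ : Signature} {l : List σ.Srt} : Terms σ l → Set (σ.Srt × ℕ)
  | .nil => ∅
  | .cons t ts => t.fv ∪ ts.fv

/-- The free variables of a formula. -/
def Formula.fv {σ : Signature} : Formula σ → Set (σ.Srt × ℕ)
  | .eq t t' => t.fv ∪ t'.fv
  | .rel _ ts => ts.fv
  | .neg φ => φ.fv
  | .or φ ψ => φ.fv ∪ ψ.fv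
  | .and φ ψ => φ.fv ∪ ψ.fv
  | .ex s x φ => φ.fv \ {(s, x)}
  | .all s x φ => φ.fv \ {(s, x)}
  | .next φ => φ.fv
  | .untl φ ψ => φ.fv ∪ ψ.fv
  | .release φ ψ => φ.fv ∪ ψ.fv

def Formula.Closed {σ : Signature} (φ : Formula σ) : Prop := φ.fv = ∅

/-- The relation symbols that occur in a formula. -/
def Formula.relSyms {σ : Signature} : Formula σ → Set σ.Rel
  | .eq _ _ => ∅
  | .rel R _ => {R}
  | .neg φ => φ.relSyms
  | .or φ ψ => φ.relSyms ∪ ψ.relSyms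
  | .and φ ψ => φ.relSyms ∪ ψ.relSyms
  | .ex _ _ φ => φ.relSyms
  | .all _ _ φ => φ.relSyms
  | .next φ => φ.relSyms
  | .untl φ ψ => φ.relSyms ∪ ψ.relSyms
  | .release φ ψ => φ.relSyms ∪ ψ.relSyms

/-! ## Semantics -/

/-- Tuples `U_{s₁} × ⋯ × U_{sₖ}`. -/
def Tuple {S : Type} (U : S → Type) : List S → Type
  | [] => Unit
  | s :: l => U s × Tuple U l

/-- The rigid part of a temporal structure: non-empty universes and the values of the
constants. -/
structure Domain (σ : Signature) where
  U : σ.Srt → Type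
  nonempty : ∀ s, Nonempty (U s)
  con : ∀ c : σ.Con, U (σ.conSort c)

/-- The flexible part of a temporal structure: the relations at every time point. A temporal
structure is a pair of a `D : Domain σ` and a `τ : Trace D`. -/
abbrev Trace {σ : Signature} (D : Domain σ) : Type :=
  ℕ → ∀ R : σ.Rel, Set (Tuple D.U (σ.arity R))

/-- The suffix `τ[j, ∞]`. -/
def Trace.drop {σ : Signature} {D : Domain σ} (τ : Trace D) (j : ℕ) : Trace D :=
  fun i => τ (j + i)

/-- Valuations of the first-order variables. -/
abbrev Val {σ : Signature} (D : Domain σ) : Type := ∀ s : σ.Srt, ℕ → D.U s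

open Classical in
/-- The valuation `ν[x ↦ d]`, where `x` is the variable `(s, n)`. -/
noncomputable def Val.set {σ : Signature} {D : Domain σ} (ν : Val D) (s : σ.Srt) (n : ℕ)
    (d : D.U s) : Val D :=
  Function.update ν s (Function.update (ν s) n d)

def Term.eval {σ : Signature} {D : Domain σ} (ν : Val D) {s : σ.Srt} : Term σ s → D.U s
  | .var s n => ν s n
  | .con c => D.con c

def Terms.eval {σ : Signature} {D : Domain σ} (ν : Val D) {l : List σ.Srt} :
    Terms σ l → Tuple D.U l
  | .nil => ()
  | .cons t ts => (t.eval ν, ts.eval ν)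

/-- `φ.Holds τ ν` is the satisfaction relation `τ, ν ⊨ φ`. -/
def Formula.Holds {σ : Signature} {D : Domain σ} : Formula σ → Trace D → Val D → Prop
  | .eq t t', _, ν => t.eval ν = t'.eval ν
  | .rel R ts, τ, ν => ts.eval ν ∈ τ 0 R
  | .neg φ, τ, ν => ¬ φ.Holds τ ν
  | .or φ ψ, τ, ν => φ.Holds τ ν ∨ ψ.Holds τ ν
  | .and φ ψ, τ, ν => φ.Holds τ ν ∧ ψ.Holds τ ν
  | .ex s x φ, τ, ν => ∃ d : D.U s, φ.Holds τ (ν.set s x d)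
  | .all s x φ, τ, ν => ∀ d : D.U s, φ.Holds τ (ν.set s x d)
  | .next φ, τ, ν => φ.Holds (τ.drop 1) ν
  | .untl φ ψ, τ, ν => ∃ j, ψ.Holds (τ.drop j) ν ∧ ∀ k < j, φ.Holds (τ.drop k) ν
  | .release φ ψ, τ, ν => ¬ ∃ j, ¬ ψ.Holds (τ.drop j) ν ∧ ∀ k < j, ¬ φ.Holds (τ.drop k) ν

def Formula.Satisfiable {σ : Signature} (φ : Formula σ) : Prop :=
  ∃ (D : Domain σ) (τ : Trace D) (ν : Val D), φ.Holds τ ν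

/-! ## The fragment BS-FOLTL -/

/-- Negation normal form: negation stands only in front of atomic formulas. -/
def Formula.IsNNF {σ : Signature} : Formula σ → Prop
  | .eq _ _ => True
  | .rel _ _ => True
  | .neg (.eq _ _) => True
  | .neg (.rel _ _) => True
  | .neg _ => False
  | .or φ ψ => φ.IsNNF ∧ ψ.IsNNF
  | .and φ ψ => φ.IsNNF ∧ ψ.IsNNF
  | .ex _ _ φ => φ.IsNNF
  | .all _ _ φ => φ.IsNNF
  | .next φ => φ.IsNNF
  | .untl φ ψ => φ.IsNNF ∧ ψ.IsNNF
  | .release φ ψ => φ.IsNNF ∧ ψ.IsNNF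

/-- The formula contains no existential quantifier. -/
def Formula.ExFree {σ : Signature} : Formula σ → Prop
  | .eq _ _ => True
  | .rel _ _ => True
  | .neg φ => φ.ExFree
  | .or φ ψ => φ.ExFree ∧ ψ.ExFree
  | .and φ ψ => φ.ExFree ∧ ψ.ExFree
  | .ex _ _ _ => False
  | .all _ _ φ => φ.ExFree
  | .next φ => φ.ExFree
  | .untl φ ψ => φ.ExFree ∧ ψ.ExFree
  | .release φ ψ => φ.ExFree ∧ ψ.ExFree

/-- The formula has the form `∃ x₁, …, xₖ. φ'` with `k ≥ 0` and no existential quantifier in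
`φ'`. -/
inductive Formula.IsExPrefix {σ : Signature} : Formula σ → Prop
  | base {φ : Formula σ} (h : φ.ExFree) : IsExPrefix φ
  | ex (s : σ.Srt) (x : ℕ) {φ : Formula σ} (h : IsExPrefix φ) : IsExPrefix (.ex s x φ)

open Classical in
/-- What remains of an arity when the sorts other than `s` are removed. -/
noncomputable def projArity {S : Type} (s : S) : List S → List Unit
  | [] => []
  | s' :: l => if s' = s then () :: projArity s l else projArity s l

open Classical in
/-- The one-sorted signature of the projections on the sort `s`. The symbol `Sum.inr s'` is the
nullary remainder of the equality on a sort `s' ≠ s`, whose two terms are removed. -/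
noncomputable abbrev Signature.proj (σ : Signature) (s : σ.Srt) : Signature where
  Srt := Unit
  Con := {c : σ.Con // σ.conSort c = s}
  Rel := σ.Rel ⊕ σ.Srt
  conSort := fun _ => ()
  arity := Sum.elim (fun R => projArity s (σ.arity R)) (fun _ => [])

/-- A term of sort `s`, seen as a term of the projected signature. -/
def Term.proj {σ : Signature} {s s' : σ.Srt} : Term σ s' → s' = s → Term (σ.proj s) ()
  | .var _ n, _ => .var (σ := σ.proj s) () n
  | .con c, h => .con (σ := σ.proj s) ⟨c, h⟩

open Classical in
/-- Removes the terms of sorts other than `s`. -/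
noncomputable def Terms.proj {σ : Signature} (s : σ.Srt) :
    {l : List σ.Srt} → Terms σ l → Terms (σ.proj s) (projArity s l)
  | [], .nil => .nil
  | s' :: l, .cons t ts =>
    if h : s' = s then
      have e : projArity s (s' :: l) = () :: projArity s l := if_pos h
      e ▸ .cons (t.proj h) (ts.proj s)
    else
      have e : projArity s (s' :: l) = projArity s l := if_neg h
      e ▸ ts.proj s

open Classical in
/-- The projection of a formula on the sort `s`: all quantifications over, and all terms of, the
other sorts are removed. -/
noncomputable def Formula.proj {σ : Signature} (s : σ.Srt) : Formula σ → Formula (σ.proj s)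
  | .eq (s := s') t t' =>
    if h : s' = s then .eq (t.proj h) (t'.proj h)
    else .rel (σ := σ.proj s) (Sum.inr s') .nil
  | .rel R ts => .rel (σ := σ.proj s) (Sum.inl R) (ts.proj s)
  | .neg φ => .neg (φ.proj s)
  | .or φ ψ => .or (φ.proj s) (ψ.proj s)
  | .and φ ψ => .and (φ.proj s) (ψ.proj s)
  | .ex s' x φ => if s' = s then .ex (σ := σ.proj s) () x (φ.proj s) else φ.proj s
  | .all s' x φ => if s' = s then .all (σ := σ.proj s) () x (φ.proj s) else φ.proj s
  | .next φ => .next (φ.proj s)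
  | .untl φ ψ => .untl (φ.proj s) (ψ.proj s)
  | .release φ ψ => .release (φ.proj s) (ψ.proj s)

/-- The fragment BS-FOLTL. -/
def Formula.IsBS {σ : Signature} (φ : Formula σ) : Prop :=
  φ.Closed ∧ φ.IsNNF ∧ ∀ s : σ.Srt, (φ.proj s).IsExPrefix

/-! ## HyperFOLTL -/

/-- The signature with a relation symbol `R_π = (R, π)` for every relation symbol `R` and every
trace variable `π`. The trace variables are the natural numbers. -/
abbrev Signature.hyper (σ : Signature) : Signature where
  Srt := σ.Srt
  Con := σ.Con
  Rel := σ.Rel × ℕ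
  conSort := σ.conSort
  arity := fun Rπ => σ.arity Rπ.1

/-- HyperFOLTL formulas, with universal trace quantification as a primitive. -/
inductive HFormula (σ : Signature) : Type
  | ex (π : ℕ) (ψ : HFormula σ) : HFormula σ
  | all (π : ℕ) (ψ : HFormula σ) : HFormula σ
  | neg (ψ : HFormula σ) : HFormula σ
  | fo (φ : Formula σ.hyper) : HFormula σ

/-- The free first-order variables. -/
def HFormula.fv {σ : Signature} : HFormula σ → Set (σ.Srt × ℕ)
  | .ex _ ψ => ψ.fv
  | .all _ ψ => ψ.fv
  | .neg ψ => ψ.fv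
  | .fo φ => φ.fv

/-- The free trace variables. -/
def HFormula.freeTraces {σ : Signature} : HFormula σ → Set ℕ
  | .ex π ψ => ψ.freeTraces \ {π}
  | .all π ψ => ψ.freeTraces \ {π}
  | .neg ψ => ψ.freeTraces
  | .fo φ => {π | ∃ R : σ.Rel, ((R, π) : σ.Rel × ℕ) ∈ φ.relSyms}

def HFormula.Closed {σ : Signature} (ψ : HFormula σ) : Prop :=
  ψ.fv = ∅ ∧ ψ.freeTraces = ∅

/-- The domain, as a domain for the signature with the symbols `R_π`. -/
abbrev Domain.hyper {σ : Signature} (D : Domain σ) : Domain σ.hyper where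
  U := D.U
  nonempty := D.nonempty
  con := D.con

/-- The temporal structure in which `R_π` is interpreted at time `i` as `R` is in `β π` at
time `i`. -/
def hyperTrace {σ : Signature} {D : Domain σ} {T : Set (Trace D)} (β : ℕ → T) :
    Trace D.hyper :=
  fun i Rπ => (β Rπ.2).1 i Rπ.1

/-- `ψ.Holds α β` is the satisfaction relation `T, α, β ⊨ ψ`. The elements of `T` are temporal
structures with the same universes and the same values of the constants. -/
def HFormula.Holds {σ : Signature} {D : Domain σ} {T : Set (Trace D)} :
    HFormula σ → Val D → (ℕ → T) → Prop
  | .ex π ψ, α, β => ∃ t : T, ψ.Holds α (Function.update β π t)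
  | .all π ψ, α, β => ∀ t : T, ψ.Holds α (Function.update β π t)
  | .neg ψ, α, β => ¬ ψ.Holds α β
  | .fo φ, α, β => φ.Holds (D := D.hyper) (hyperTrace β) α

/-- There are a set `T` of temporal structures and valuations `α : V → U` and `β : Π → T` such
that `T, α, β ⊨ ψ`. -/
def HFormula.Satisfiable {σ : Signature} (ψ : HFormula σ) : Prop :=
  ∃ (D : Domain σ) (T : Set (Trace D)) (α : Val D) (β : ℕ → T), ψ.Holds α β

/-- The fragment `∃*_π ∀*_π BS-FOLTL`: the formulas `∃ π₁ … πₖ. ∀ π'₁ … π'ₗ. φ` with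
`k, l ≥ 0` and `φ` in BS-FOLTL. -/
def HFormula.IsExAllBS {σ : Signature} (ψ : HFormula σ) : Prop :=
  ∃ (πs πs' : List ℕ) (φ : Formula σ.hyper),
    φ.IsBS ∧ ψ = πs.foldr HFormula.ex (πs'.foldr HFormula.all (HFormula.fo φ))

/-! ## The encoding with a trace sort -/

/-- The signature with a new sort `none`, the trace sort, in which every relation symbol takes
an additional first argument of the trace sort. -/
abbrev Signature.trace (σ : Signature) : Signature where
  Srt := Option σ.Srt
  Con := σ.Con
  Rel := σ.Rel
  conSort := fun c => some (σ.conSort c)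
  arity := fun R => none :: (σ.arity R).map some

def Term.trace {σ : Signature} {s : σ.Srt} : Term σ.hyper s → Term σ.trace (some s)
  | .var s n => .var (σ := σ.trace) (some s) n
  | .con c => .con (σ := σ.trace) c

def Terms.trace {σ : Signature} : {l : List σ.Srt} → Terms σ.hyper l →
    Terms σ.trace (l.map some)
  | [], .nil => .nil
  | _ :: _, .cons t ts => .cons (Term.trace t) (Terms.trace ts)

/-- Replaces every atom `R_π(u)` by `R(π, u)`, with `π` as a variable of the trace sort. -/
def Formula.trace {σ : Signature} : Formula σ.hyper → Formula σ.trace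
  | .eq t t' => .eq (Term.trace t) (Term.trace t')
  | .rel Rπ ts => .rel (σ := σ.trace) Rπ.1 (.cons (.var (σ := σ.trace) none Rπ.2) (Terms.trace ts))
  | .neg φ => .neg (Formula.trace φ)
  | .or φ ψ => .or (Formula.trace φ) (Formula.trace ψ)
  | .and φ ψ => .and (Formula.trace φ) (Formula.trace ψ)
  | .ex s x φ => .ex (σ := σ.trace) (some s) x (Formula.trace φ)
  | .all s x φ => .all (σ := σ.trace) (some s) x (Formula.trace φ)
  | .next φ => .next (Formula.trace φ)
  | .untl φ ψ => .untl (Formula.trace φ) (Formula.trace ψ)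
  | .release φ ψ => .release (Formula.trace φ) (Formula.trace ψ)

/-- The encoding of HyperFOLTL in FOLTL: trace variables become first-order variables of the
trace sort. -/
def HFormula.trace {σ : Signature} : HFormula σ → Formula σ.trace
  | .ex π ψ => .ex (σ := σ.trace) none π ψ.trace
  | .all π ψ => .all (σ := σ.trace) none π ψ.trace
  | .neg ψ => .neg ψ.trace
  | .fo φ => φ.trace

/-! ## Formulas and finite signatures as inputs of algorithms -/

def Term.code {σ : Signature} {s : σ.Srt} : Term σ s → ℕ
  | .var _ n => Nat.pair 0 n
  | .con c => Nat.pair 1 (Encodable.encode c)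

def Terms.code {σ : Signature} {l : List σ.Srt} : Terms σ l → ℕ
  | .nil => 0
  | .cons t ts => Nat.pair t.code ts.code + 1

/-- A Gödel numbering of the FOLTL formulas. -/
def Formula.code {σ : Signature} : Formula σ → ℕ
  | .eq (s := s) t t' => Nat.pair 1 (Nat.pair (Encodable.encode s) (Nat.pair t.code t'.code))
  | .rel R ts => Nat.pair 2 (Nat.pair (Encodable.encode R) ts.code)
  | .neg φ => Nat.pair 3 φ.code
  | .or φ ψ => Nat.pair 4 (Nat.pair φ.code ψ.code)
  | .and φ ψ => Nat.pair 5 (Nat.pair φ.code ψ.code)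
  | .ex s x φ => Nat.pair 6 (Nat.pair (Nat.pair (Encodable.encode s) x) φ.code)
  | .all s x φ => Nat.pair 7 (Nat.pair (Nat.pair (Encodable.encode s) x) φ.code)
  | .next φ => Nat.pair 8 φ.code
  | .untl φ ψ => Nat.pair 9 (Nat.pair φ.code ψ.code)
  | .release φ ψ => Nat.pair 10 (Nat.pair φ.code ψ.code)

/-- A Gödel numbering of the HyperFOLTL formulas. -/
def HFormula.code {σ : Signature} : HFormula σ → ℕ
  | .ex π ψ => Nat.pair 1 (Nat.pair π ψ.code)
  | .all π ψ => Nat.pair 2 (Nat.pair π ψ.code)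
  | .neg ψ => Nat.pair 3 ψ.code
  | .fo φ => Nat.pair 4 φ.code

/-- Finite signatures with at least one sort, as finite data. -/
structure FinSignature where
  /-- The sorts are `0, …, lastSort`. -/
  lastSort : ℕ
  numCon : ℕ
  numRel : ℕ
  conSort : Fin numCon → Fin (lastSort + 1)
  arity : Fin numRel → List (Fin (lastSort + 1))

abbrev FinSignature.toSignature (S : FinSignature) : Signature where
  Srt := Fin (S.lastSort + 1)
  Con := Fin S.numCon
  Rel := Fin S.numRel
  conSort := S.conSort
  arity := S.arity

/-- A Gödel numbering of the finite signatures. -/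
def FinSignature.code (S : FinSignature) : ℕ :=
  Encodable.encode (S.lastSort, List.ofFn (fun c => (S.conSort c).val),
    List.ofFn (fun R => (S.arity R).map Fin.val))

end FOLTL

-- Trace encoding. A set of traces can itself serve as the universe of the trace sort, the new first
-- argument of a relation selecting the trace. Conversely every element `m` of the trace sort has a
-- trace `row τ m`, and the set of all rows is a HyperFOLTL model. Distinct elements may have equal
-- rows; this is harmless, since encoded formulas contain no equality on the trace sort. On codes
-- the encoding is a course-of-values recursion.
--
-- Decidability. The encoding of a formula of the fragment is stratified: its existential
-- quantifiers stand in a prefix in which none over a sort follows a universal one over the same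
-- sort. Witnesses can therefore be collected along the prefix: a universal quantifier freezes the
-- finite set chosen for its sort, so later witnesses, which are of other sorts, need to be chosen
-- for finitely many instances only. The remaining matrix is universal and passes to the chosen
-- subsets (`Formula.IsStratified.exists_finset`). Each quantifier at most squares the size bound,
-- so universes of at most `(2 * M) ^ 2 ^ M` elements suffice, where `M` exceeds the codes involved.
--
-- Over universes of bounded size there are finitely many pairs of a formula code and a valuation,
-- and the problem becomes propositional LTL. A type is a set of such pairs, meant to be those that
-- hold at one time. A certificate is a finite set of types in which each type has a locally
-- consistent successor and no pending until formula, or pending violation of a release formula, can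
-- trap a path. A fair path through a certificate yields a model (`IsCertificate.exists_codeHolds`);
-- the types occurring in a model form a certificate (`exists_isCertificate`). Types, sets of types
-- and valuations are coded as numbers below explicit bounds, so the search for a certificate is
-- primitive recursive. The closure rules for `Primrec` and `PrimrecPred` are registered with
-- `fun_prop` to make this automatic.

attribute [fun_prop] Primrec PrimrecPred

namespace FOLTL

/-! ## Primitive recursion: closure properties as `fun_prop` rules -/

section Primrec

variable {α β γ : Type} [Primcodable α] [Primcodable β] [Primcodable γ]

@[fun_prop]
theorem primrec_id : Primrec (fun a : α => a) := Primrec.id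

@[fun_prop]
theorem primrec_const (b : β) : Primrec (fun _ : α => b) := Primrec.const b

@[fun_prop]
theorem primrec_comp {f : β → γ} {g : α → β} (hf : Primrec f) (hg : Primrec g) :
    Primrec (fun a => f (g a)) := hf.comp hg

@[fun_prop]
theorem primrec_mk {f : α → β} {g : α → γ} (hf : Primrec f) (hg : Primrec g) :
    Primrec (fun a => (f a, g a)) := hf.pair hg

@[fun_prop]
theorem primrec_fst {f : α → β × γ} (hf : Primrec f) : Primrec (fun a => (f a).1) :=
  Primrec.fst.comp hf

@[fun_prop]
theorem primrec_snd {f : α → β × γ} (hf : Primrec f) : Primrec (fun a => (f a).2) :=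
  Primrec.snd.comp hf

@[fun_prop]
theorem primrec_add {f g : α → ℕ} (hf : Primrec f) (hg : Primrec g) :
    Primrec (fun a => f a + g a) := Primrec.nat_add.comp hf hg

@[fun_prop]
theorem primrec_mul {f g : α → ℕ} (hf : Primrec f) (hg : Primrec g) :
    Primrec (fun a => f a * g a) := Primrec.nat_mul.comp hf hg

@[fun_prop]
theorem primrec_pow {f g : α → ℕ} (hf : Primrec f) (hg : Primrec g) :
    Primrec (fun a => f a ^ g a) :=
  (Primrec₂.unpaired'.1 Nat.Primrec.pow).comp hf hg

@[fun_prop]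
theorem primrec_div {f g : α → ℕ} (hf : Primrec f) (hg : Primrec g) :
    Primrec (fun a => f a / g a) := Primrec.nat_div.comp hf hg

@[fun_prop]
theorem primrec_mod {f g : α → ℕ} (hf : Primrec f) (hg : Primrec g) :
    Primrec (fun a => f a % g a) := Primrec.nat_mod.comp hf hg

@[fun_prop]
theorem primrec_min {f g : α → ℕ} (hf : Primrec f) (hg : Primrec g) :
    Primrec (fun a => min (f a) (g a)) := Primrec.nat_min.comp hf hg

@[fun_prop]
theorem primrec_pair {f g : α → ℕ} (hf : Primrec f) (hg : Primrec g) :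
    Primrec (fun a => Nat.pair (f a) (g a)) := Primrec₂.natPair.comp hf hg

@[fun_prop]
theorem primrec_unpair {f : α → ℕ} (hf : Primrec f) : Primrec (fun a => Nat.unpair (f a)) :=
  Primrec.unpair.comp hf

@[fun_prop]
theorem primrec_ite {p : α → Prop} [DecidablePred p] {f g : α → β} (hp : PrimrecPred p)
    (hf : Primrec f) (hg : Primrec g) : Primrec (fun a => if p a then f a else g a) :=
  Primrec.ite hp hf hg

@[fun_prop]
theorem primrec_getD {f : α → List β} {g : α → ℕ} (d : β) (hf : Primrec f) (hg : Primrec g) :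
    Primrec (fun a => (f a).getD (g a) d) := (Primrec.list_getD d).comp hf hg

@[fun_prop]
theorem primrec_map {f : α → List β} {g : α → β → γ} (hf : Primrec f)
    (hg : Primrec fun q : α × β => g q.1 q.2) : Primrec (fun a => (f a).map (g a)) :=
  Primrec.list_map hf hg

@[fun_prop]
theorem primrec_range {f : α → ℕ} (hf : Primrec f) : Primrec (fun a => List.range (f a)) :=
  Primrec.list_range.comp hf

@[fun_prop]
theorem primrec_length {f : α → List β} (hf : Primrec f) : Primrec (fun a => (f a).length) :=
  Primrec.list_length.comp hf

@[fun_prop]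
theorem primrec_cons {f : α → β} {g : α → List β} (hf : Primrec f) (hg : Primrec g) :
    Primrec (fun a => f a :: g a) := Primrec.list_cons.comp hf hg

/-- Decoding with a default value. -/
def decodeD (b : β) (n : ℕ) : β := (Encodable.decode n).getD b

theorem decodeD_encode (b c : β) : decodeD b (Encodable.encode c) = c := by
  simp [decodeD]

@[fun_prop]
theorem primrec_decodeD {f : α → ℕ} (b : β) (hf : Primrec f) :
    Primrec (fun a => decodeD b (f a)) :=
  Primrec.option_getD.comp (Primrec.decode.comp hf) (Primrec.const b)

@[fun_prop]
theorem primrecPred_const (p : Prop) : PrimrecPred (fun _ : α => p) := by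
  classical
  exact ⟨fun _ => inferInstance, Primrec.const _⟩

@[fun_prop]
theorem primrecPred_and {p q : α → Prop} (hp : PrimrecPred p) (hq : PrimrecPred q) :
    PrimrecPred (fun a => p a ∧ q a) := hp.and hq

@[fun_prop]
theorem primrecPred_or {p q : α → Prop} (hp : PrimrecPred p) (hq : PrimrecPred q) :
    PrimrecPred (fun a => p a ∨ q a) := hp.or hq

@[fun_prop]
theorem primrecPred_not {p : α → Prop} (hp : PrimrecPred p) :
    PrimrecPred (fun a => ¬ p a) := hp.not

theorem PrimrecPred.imp {p q : α → Prop} (hp : PrimrecPred p) (hq : PrimrecPred q) :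
    PrimrecPred (fun a => p a → q a) :=
  (hp.not.or hq).of_eq fun _ => imp_iff_not_or.symm

@[fun_prop]
theorem primrecPred_iff {p q : α → Prop} (hp : PrimrecPred p) (hq : PrimrecPred q) :
    PrimrecPred (fun a => p a ↔ q a) :=
  ((PrimrecPred.imp hp hq).and (PrimrecPred.imp hq hp)).of_eq fun _ =>
    iff_iff_implies_and_implies.symm

@[fun_prop]
theorem primrecPred_eq {f g : α → β} (hf : Primrec f) (hg : Primrec g) :
    PrimrecPred (fun a => f a = g a) := Primrec.eq.comp hf hg

@[fun_prop]
theorem primrecPred_ite {p q r : α → Prop} [DecidablePred p] (hp : PrimrecPred p)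
    (hq : PrimrecPred q) (hr : PrimrecPred r) :
    PrimrecPred (fun a => if p a then q a else r a) :=
  ((hp.and hq).or (hp.not.and hr)).of_eq fun a => by by_cases h : p a <;> simp [h]

/-- Bounded existential quantification. -/
def BEx (n : ℕ) (p : ℕ → Prop) : Prop := ∃ x < n, p x

/-- Bounded universal quantification. -/
def BAll (n : ℕ) (p : ℕ → Prop) : Prop := ∀ x < n, p x

@[fun_prop]
theorem primrecPred_bEx {f : α → ℕ} {p : α → ℕ → Prop} (hf : Primrec f)
    (hp : PrimrecPred fun q : α × ℕ => p q.1 q.2) :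
    PrimrecPred (fun a => BEx (f a) (p a)) := by
  have : PrimrecRel (fun (x : ℕ) (a : α) => p a x) := hp.comp (Primrec.snd.pair Primrec.fst)
  exact (this.exists_mem_list.comp (Primrec.list_range.comp hf) primrec_id).of_eq
    (by simp [BEx])

@[fun_prop]
theorem primrecPred_bAll {f : α → ℕ} {p : α → ℕ → Prop} (hf : Primrec f)
    (hp : PrimrecPred fun q : α × ℕ => p q.1 q.2) :
    PrimrecPred (fun a => BAll (f a) (p a)) := by
  have : PrimrecRel (fun (x : ℕ) (a : α) => p a x) := hp.comp (Primrec.snd.pair Primrec.fst)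
  exact (this.forall_mem_list.comp (Primrec.list_range.comp hf) primrec_id).of_eq
    (by simp [BAll])

/-- Course-of-values recursion. -/
theorem exists_primrec_of_body (body : ℕ → (ℕ → ℕ) → ℕ)
    (h : Primrec fun p : ℕ × List ℕ => body p.1 (fun k => p.2.getD k 0)) :
    ∃ f : ℕ → ℕ, Primrec f ∧ ∀ n, f n = body n (fun k => if k < n then f k else 0) := by
  let f : ℕ → ℕ := fun n => n.strongRec fun n r => body n (fun k => if h : k < n then r k h else 0)
  have hf : ∀ n, f n = body n (fun k => if k < n then f k else 0) := fun n => by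
    simp only [f]
    rw [Nat.strongRec]
    simp
  refine ⟨f, ?_, hf⟩
  -- The strong recursion supplies the list of all earlier values; reading it with default 0 agrees
  -- with the value 0 that `body` sees at arguments `k ≥ n`.
  have := Primrec.nat_strong_rec (fun (_ : Unit) => f)
    (g := fun _ l => some (body l.length (fun k => l.getD k 0))) ?_ ?_
  · exact Primrec₂.comp (f := fun (_ : Unit) => f) this (Primrec.const ()) Primrec.id
  · refine Primrec.option_some.comp (h.comp (f := fun p : ℕ × List ℕ =>
      body p.1 (fun k => p.2.getD k 0)) (g := fun q : Unit × List ℕ => (q.2.length, q.2)) ?_)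
    fun_prop
  · intro _ n
    simp only [List.length_map, List.length_range, Option.some.injEq]
    rw [hf n]
    congr 1
    funext k
    by_cases hk : k < n <;> simp [List.getD, hk]

end Primrec

/-- All constructor tags are at least 1, so this makes recursion on codes descend. It fails for `a =
0`, since `Nat.pair 0 0 = 0`. -/
theorem lt_pair_right {a : ℕ} (h : 1 ≤ a) (b : ℕ) : b < Nat.pair a b := by
  unfold Nat.pair
  split_ifs <;> nlinarith

/-! ## The trace encoding is computable -/

/-- The trace encoding on codes of formulas, with `r` for the recursive calls. -/
def formulaTraceBody (n : ℕ) (r : ℕ → ℕ) : ℕ :=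
  if n.unpair.1 = 1 then
    -- In `Option σ.Srt` the trace sort has code 0 and the codes of the old sorts move up by one.
    Nat.pair 1 (Nat.pair (n.unpair.2.unpair.1 + 1) n.unpair.2.unpair.2)
  else if n.unpair.1 = 2 then
    -- The symbol `R_π` is coded as a pair; its second half becomes the variable with code `Nat.pair
    -- 0 π`, put in front of the coded argument list.
    Nat.pair 2 (Nat.pair n.unpair.2.unpair.1.unpair.1
      (Nat.pair (Nat.pair 0 n.unpair.2.unpair.1.unpair.2) n.unpair.2.unpair.2 + 1))
  else if n.unpair.1 = 3 ∨ n.unpair.1 = 8 then Nat.pair n.unpair.1 (r n.unpair.2)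
  else if n.unpair.1 = 6 ∨ n.unpair.1 = 7 then
    Nat.pair n.unpair.1 (Nat.pair (Nat.pair (n.unpair.2.unpair.1.unpair.1 + 1)
      n.unpair.2.unpair.1.unpair.2) (r n.unpair.2.unpair.2))
  else Nat.pair n.unpair.1 (Nat.pair (r n.unpair.2.unpair.1) (r n.unpair.2.unpair.2))

theorem Term.code_trace {σ : Signature} {s : σ.Srt} (t : Term σ.hyper s) :
    (Term.trace t).code = Term.code (σ := σ.hyper) t :=
  match s, t with
  | _, .var _ _ => rfl
  | _, .con _ => rfl

theorem Terms.code_trace {σ : Signature} : ∀ {l : List σ.Srt} (ts : Terms σ.hyper l),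
    (Terms.trace ts).code = Terms.code (σ := σ.hyper) ts
  | _, .nil => rfl
  | _, .cons t ts => by
    simp only [Terms.trace, Terms.code, Term.code_trace, Terms.code_trace ts]

theorem exists_formulaTrace : ∃ f : ℕ → ℕ, Primrec f ∧
    ∀ (σ : Signature) (φ : Formula σ.hyper), f φ.code = φ.trace.code := by
  obtain ⟨f, hp, hf⟩ := exists_primrec_of_body formulaTraceBody (by
    unfold formulaTraceBody; fun_prop)
  refine ⟨f, hp, fun σ φ => ?_⟩
  have h1 : ∀ a b, 1 ≤ a → b < Nat.pair a b := fun a b h => lt_pair_right h b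
  have hl : ∀ {a b c}, 1 ≤ a → b < Nat.pair a (Nat.pair b c) := fun h =>
    (Nat.left_le_pair _ _).trans_lt (lt_pair_right h _)
  have hr : ∀ {a b c}, 1 ≤ a → c < Nat.pair a (Nat.pair b c) := fun h =>
    (Nat.right_le_pair _ _).trans_lt (lt_pair_right h _)
  induction φ with
  | eq t t' =>
    rw [hf]
    simp only [Formula.code, Formula.trace, formulaTraceBody, Nat.unpair_pair, Term.code_trace]
    rfl
  | rel R ts =>
    have hR : Encodable.encode R = Nat.pair (Encodable.encode R.1) R.2 := rfl
    rw [hf]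
    simp [Formula.code, Formula.trace, formulaTraceBody, Terms.code, Terms.code_trace, Term.code,
      hR]
  | neg φ ih | next φ ih =>
    rw [hf]
    simp [Formula.code, Formula.trace, formulaTraceBody, h1, ih]
  | or φ ψ ih1 ih2 | and φ ψ ih1 ih2 | untl φ ψ ih1 ih2 | release φ ψ ih1 ih2 =>
    rw [hf]
    simp [Formula.code, Formula.trace, formulaTraceBody, hl, hr, ih1, ih2]
  | ex s x φ ih | all s x φ ih =>
    rw [hf]
    simp [Formula.code, Formula.trace, formulaTraceBody, hr, ih]

/-- The trace encoding on codes of HyperFOLTL formulas, with `r` for the recursive calls. -/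
def hformulaTraceBody (f : ℕ → ℕ) (n : ℕ) (r : ℕ → ℕ) : ℕ :=
  if n.unpair.1 = 1 then
    Nat.pair 6 (Nat.pair (Nat.pair 0 n.unpair.2.unpair.1) (r n.unpair.2.unpair.2))
  else if n.unpair.1 = 2 then
    Nat.pair 7 (Nat.pair (Nat.pair 0 n.unpair.2.unpair.1) (r n.unpair.2.unpair.2))
  else if n.unpair.1 = 3 then Nat.pair 3 (r n.unpair.2)
  else f n.unpair.2

theorem exists_hformulaTrace : ∃ f : ℕ → ℕ, Primrec f ∧
    ∀ (σ : Signature) (ψ : HFormula σ), f ψ.code = ψ.trace.code := by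
  obtain ⟨g, hg, hgt⟩ := exists_formulaTrace
  obtain ⟨f, hp, hf⟩ := exists_primrec_of_body (hformulaTraceBody g) (by
    unfold hformulaTraceBody; fun_prop)
  refine ⟨f, hp, fun σ ψ => ?_⟩
  have h1 : ∀ a b, 1 ≤ a → b < Nat.pair a b := fun a b h => lt_pair_right h b
  have hr : ∀ {a b c}, 1 ≤ a → c < Nat.pair a (Nat.pair b c) := fun h =>
    (Nat.right_le_pair _ _).trans_lt (lt_pair_right h _)
  induction ψ with
  | ex π ψ ih | all π ψ ih =>
    rw [hf]
    simp [HFormula.code, HFormula.trace, hformulaTraceBody, Formula.code, hr, ih]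
  | neg ψ ih =>
    rw [hf]
    simp [HFormula.code, HFormula.trace, hformulaTraceBody, Formula.code, h1, ih]
  | fo φ =>
    rw [hf]
    simp [HFormula.code, HFormula.trace, hformulaTraceBody, hgt]

/-! ## The trace encoding preserves satisfiability -/

theorem Val.set_self {σ : Signature} {D : Domain σ} (ν : Val D) (s : σ.Srt) (n : ℕ) (d : D.U s) :
    ν.set s n d s = Function.update (ν s) n d := by
  simp [Val.set]

theorem Val.set_of_ne {σ : Signature} {D : Domain σ} (ν : Val D) {s s' : σ.Srt} (h : s' ≠ s)
    (n : ℕ) (d : D.U s) : ν.set s n d s' = ν s' := by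
  simp [Val.set, h]

theorem Trace.drop_drop {σ : Signature} {D : Domain σ} (τ : Trace D) (i j : ℕ) :
    (τ.drop i).drop j = τ.drop (i + j) := by
  funext k
  simp [Trace.drop, Nat.add_assoc]

section Trace

variable {σ : Signature}

/-- The part of a domain of the trace encoding that belongs to the original sorts. -/
abbrev Domain.base (E : Domain σ.trace) : Domain σ where
  U := fun s => E.U (some s)
  nonempty := fun s => E.nonempty (some s)
  con := fun c => E.con c

/-- A valuation of the trace encoding on the original sorts. -/
def Val.base {E : Domain σ.trace} (ν : Val E) : Val E.base := fun s n => ν (some s) n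

/-- A tuple of elements of original sorts, as a tuple for the trace encoding. -/
def Tuple.lift {S : Type} {U : Option S → Type} :
    {l : List S} → Tuple (fun s => U (some s)) l → Tuple U (l.map some)
  | [], _ => ()
  | _ :: _, (u, us) => (u, Tuple.lift us)

/-- The inverse of `Tuple.lift`. -/
def Tuple.unlift {S : Type} {U : Option S → Type} :
    {l : List S} → Tuple U (l.map some) → Tuple (fun s => U (some s)) l
  | [], _ => ()
  | _ :: _, (u, us) => (u, Tuple.unlift us)

theorem Tuple.unlift_lift {S : Type} {U : Option S → Type} :
    {l : List S} → (us : Tuple (fun s => U (some s)) l) → Tuple.unlift (Tuple.lift us) = us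
  | [], () => rfl
  | _ :: _, (u, us) => congrArg (Prod.mk u) (Tuple.unlift_lift us)

/-- The temporal structure that an element of the trace sort stands for. -/
def row {E : Domain σ.trace} (τ : Trace E) (m : E.U none) : Trace E.base :=
  fun i R => {us | ((m, Tuple.lift us) : Tuple E.U (none :: (σ.arity R).map some)) ∈ τ i R}

theorem Term.eval_trace {E : Domain σ.trace} (ν : Val E) {s : σ.Srt} (t : Term σ.hyper s) :
    (Term.trace t).eval ν = t.eval (D := E.base.hyper) ν.base :=
  match s, t with
  | _, .var _ _ => rfl
  | _, .con _ => rfl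

theorem Terms.eval_trace {E : Domain σ.trace} (ν : Val E) : {l : List σ.Srt} →
    (ts : Terms σ.hyper l) →
      (Terms.trace ts).eval ν = Tuple.lift (ts.eval (D := E.base.hyper) ν.base)
  | _, .nil => rfl
  | _, .cons t ts => by
    simp only [Terms.trace, Terms.eval, Term.eval_trace, Terms.eval_trace ν ts]
    rfl

theorem Val.base_set {E : Domain σ.trace} (ν : Val E) (s : σ.Srt) (x : ℕ) (d : E.U (some s)) :
    Val.base (σ := σ) (ν.set (some s) x d) = (Val.base (σ := σ) ν).set s x d := by
  funext s'
  by_cases h : s' = s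
  · subst h
    rw [Val.set_self]
    funext n
    simp only [Val.base, Val.set_self]
    rfl
  · rw [Val.set_of_ne _ h]
    funext n
    have : (some s' : Option σ.Srt) ≠ some s := by simpa using h
    simp only [Val.base]
    rw [Val.set_of_ne (σ := σ.trace) ν this]

theorem Val.base_set_none {E : Domain σ.trace} (ν : Val E) (x : ℕ) (d : E.U none) :
    Val.base (σ := σ) (ν.set none x d) = Val.base (σ := σ) ν := by
  funext s' n
  have : (some s' : Option σ.Srt) ≠ none := by simp
  simp only [Val.base]
  rw [Val.set_of_ne (σ := σ.trace) ν this]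

/-- The quantifiers inside `φ` range over original sorts only, so the values of the trace variables
stay fixed throughout and `R_π` always reads the row of `ν none π`. -/
theorem Formula.holds_trace {E : Domain σ.trace} (φ : Formula σ.hyper) (τ : Trace E) (ν : Val E) :
    φ.trace.Holds τ ν ↔
      φ.Holds (D := E.base.hyper) (fun i Rπ => row τ (ν none Rπ.2) i Rπ.1) ν.base := by
  induction φ generalizing τ ν with
  | eq t t' =>
    simp only [Formula.trace, Formula.Holds, Term.eval_trace]
  | rel R ts =>
    simp only [Formula.trace, Formula.Holds, Terms.eval, Terms.eval_trace]
    rfl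
  | neg φ ih => simp only [Formula.trace, Formula.Holds, ih]
  | or φ ψ ih1 ih2 | and φ ψ ih1 ih2 => simp only [Formula.trace, Formula.Holds, ih1, ih2]
  | next φ ih =>
    simp only [Formula.trace, Formula.Holds, ih]
    rfl
  | untl φ ψ ih1 ih2 | release φ ψ ih1 ih2 =>
    simp only [Formula.trace, Formula.Holds, ih1, ih2]
    rfl
  | ex s x φ ih =>
    simp only [Formula.trace, Formula.Holds, ih, Val.base_set]
    refine exists_congr fun d => ?_
    rw [Val.set_of_ne (σ := σ.trace) ν (by simp)]
    rfl
  | all s x φ ih =>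
    simp only [Formula.trace, Formula.Holds, ih, Val.base_set]
    refine forall_congr' fun d => ?_
    rw [Val.set_of_ne (σ := σ.trace) ν (by simp)]
    rfl

/-- Only surjectivity of `row τ` onto `T` matters, not injectivity: a trace variable is used solely
through its row, so any element with the right row can stand for a trace. -/
theorem HFormula.holds_trace {E : Domain σ.trace} {τ : Trace E} {T : Set (Trace E.base)}
    (hT : ∀ m, row τ m ∈ T) (hT' : ∀ t ∈ T, ∃ m, row τ m = t) (ψ : HFormula σ) (ν : Val E)
    (β : ℕ → T) (hβ : ∀ π, (β π).1 = row τ (ν none π)) :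
    ψ.trace.Holds τ ν ↔ ψ.Holds ν.base β := by
  have upd (ν : Val E) (β : ℕ → T) (hβ : ∀ π, (β π).1 = row τ (ν none π)) (π : ℕ) (m : E.U none)
      (t : T) (ht : row τ m = t.1) (π' : ℕ) :
      (Function.update β π t π').1 = row τ (ν.set none π m none π') := by
    rw [Val.set_self]
    by_cases h : π' = π
    · subst h; simp [ht]
    · simp [h, hβ]
  induction ψ generalizing ν β with
  | fo φ =>
    simp only [HFormula.trace, HFormula.Holds, Formula.holds_trace]
    have : hyperTrace β = fun i (Rπ : σ.Rel × ℕ) => row τ (ν none Rπ.2) i Rπ.1 := by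
      funext i Rπ
      simp only [hyperTrace, hβ]
    rw [this]
  | neg ψ ih => simp only [HFormula.trace, HFormula.Holds, Formula.Holds, ih ν β hβ]
  | ex π ψ ih =>
    simp only [HFormula.trace, HFormula.Holds, Formula.Holds]
    constructor
    · rintro ⟨m, h⟩
      have := (ih _ _ (upd ν β hβ π m ⟨_, hT m⟩ rfl)).1 h
      rw [Val.base_set_none] at this
      exact ⟨_, this⟩
    · rintro ⟨t, h⟩
      obtain ⟨m, hm⟩ := hT' t.1 t.2
      refine ⟨m, (ih _ _ (upd ν β hβ π m t hm)).2 ?_⟩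
      rwa [Val.base_set_none]
  | all π ψ ih =>
    simp only [HFormula.trace, HFormula.Holds, Formula.Holds]
    constructor
    · intro h t
      obtain ⟨m, hm⟩ := hT' t.1 t.2
      have := (ih _ _ (upd ν β hβ π m t hm)).1 (h m)
      rwa [Val.base_set_none] at this
    · intro h m
      refine (ih _ _ (upd ν β hβ π m ⟨_, hT m⟩ rfl)).2 ?_
      rw [Val.base_set_none]
      exact h _

theorem HFormula.satisfiable_trace (ψ : HFormula σ) : ψ.Satisfiable ↔ ψ.trace.Satisfiable := by
  constructor
  · rintro ⟨D, T, α, β, h⟩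
    -- The traces themselves are the elements of the trace sort; `β 0` shows that there is one.
    let E : Domain σ.trace :=
      { U := fun o => match o with
          | none => T
          | some s => D.U s
        nonempty := fun o => match o with
          | none => ⟨β 0⟩
          | some s => D.nonempty s
        con := fun c => D.con c }
    let τ : Trace E := fun i R =>
      {u : Tuple E.U (none :: (σ.arity R).map some) |
        (Tuple.unlift u.2 : Tuple (fun s => D.U s) (σ.arity R)) ∈ (show T from u.1).1 i R}
    let ν : Val E := fun o => match o with
      | none => β
      | some s => α s
    have hrow (t : T) : row τ t = t.1 := by
      funext i R
      ext us
      change Tuple.unlift (Tuple.lift (U := E.U) us) ∈ t.1 i R ↔ _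
      rw [Tuple.unlift_lift]
    have hT (m : E.U none) : row τ m ∈ T := (hrow m).symm ▸ Subtype.property (show T from m)
    have hT' (t) (ht : t ∈ T) : ∃ m, row τ m = t := ⟨(⟨t, ht⟩ : T), hrow _⟩
    exact ⟨E, τ, ν, (HFormula.holds_trace hT hT' ψ ν β (fun π => (hrow _).symm)).2 h⟩
  · rintro ⟨E, τ, ν, h⟩
    exact ⟨E.base, Set.range (row τ), ν.base, fun π => ⟨row τ (ν none π), _, rfl⟩,
      (HFormula.holds_trace (T := Set.range (row τ)) (fun m => ⟨m, rfl⟩) (fun t ht => ht) ψ ν _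
        (fun _ => rfl)).1 h⟩

/-! ## The trace encoding preserves closedness -/

theorem Term.fv_trace {s : σ.Srt} (t : Term σ.hyper s) :
    (Term.trace t).fv = Prod.map some id '' t.fv :=
  match s, t with
  | _, .var _ _ => by simp [Term.trace, Term.fv]
  | _, .con _ => by simp [Term.trace, Term.fv]

theorem Terms.fv_trace : {l : List σ.Srt} → (ts : Terms σ.hyper l) →
    (Terms.trace ts).fv = Prod.map some id '' ts.fv
  | _, .nil => by simp [Terms.trace, Terms.fv]
  | _, .cons t ts => by
    simp only [Terms.trace, Terms.fv, Term.fv_trace, Terms.fv_trace ts, Set.image_union]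

/-- Variables of the trace sort enter only through the indices of relation symbols. The inclusion is
all that closedness needs. -/
theorem Formula.fv_trace (φ : Formula σ.hyper) :
    φ.trace.fv ⊆ Prod.map some id '' φ.fv ∪
      {p | p.1 = none ∧ ∃ R : σ.Rel, (R, p.2) ∈ φ.relSyms} := by
  have aux (s : σ.Srt) (x : ℕ) (A : Set (σ.Srt × ℕ)) (B C : Set (Option σ.Srt × ℕ))
      (h : C ⊆ Prod.map some id '' A ∪ B) :
      C \ {(some s, x)} ⊆ Prod.map some id '' (A \ {(s, x)}) ∪ B := by
    rintro p ⟨hp, hp'⟩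
    rcases h hp with ⟨q, hq, rfl⟩ | hB
    · refine Or.inl ⟨q, ⟨hq, ?_⟩, rfl⟩
      rintro rfl
      exact hp' rfl
    · exact Or.inr hB
  have aux2 (A A' : Set (σ.Srt × ℕ)) (B B' : Set (σ.Rel × ℕ)) (C C' : Set (Option σ.Srt × ℕ))
      (h : C ⊆ Prod.map some id '' A ∪ {p | p.1 = none ∧ ∃ R : σ.Rel, (R, p.2) ∈ B})
      (h' : C' ⊆ Prod.map some id '' A' ∪ {p | p.1 = none ∧ ∃ R : σ.Rel, (R, p.2) ∈ B'}) :
      C ∪ C' ⊆ Prod.map some id '' (A ∪ A') ∪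
        {p | p.1 = none ∧ ∃ R : σ.Rel, (R, p.2) ∈ B ∪ B'} := by
    rintro p (hp | hp)
    · rcases h hp with ⟨q, hq, rfl⟩ | ⟨h1, R, hR⟩
      · exact Or.inl ⟨q, Or.inl hq, rfl⟩
      · exact Or.inr ⟨h1, R, Or.inl hR⟩
    · rcases h' hp with ⟨q, hq, rfl⟩ | ⟨h1, R, hR⟩
      · exact Or.inl ⟨q, Or.inr hq, rfl⟩
      · exact Or.inr ⟨h1, R, Or.inr hR⟩
  induction φ with
  | eq t t' =>
    simp only [Formula.trace, Formula.fv, Term.fv_trace, Set.image_union]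
    exact Set.subset_union_left
  | rel R ts =>
    simp only [Formula.trace, Formula.fv, Terms.fv, Terms.fv_trace, Term.fv]
    rintro p (rfl | hp)
    · exact Or.inr ⟨rfl, R.1, rfl⟩
    · exact Or.inl hp
  | neg φ ih | next φ ih => exact ih
  | or φ ψ ih1 ih2 | and φ ψ ih1 ih2 | untl φ ψ ih1 ih2 | release φ ψ ih1 ih2 =>
    exact aux2 _ _ _ _ _ _ ih1 ih2
  | ex s x φ ih | all s x φ ih => exact aux s x _ _ _ ih

theorem HFormula.fv_trace (ψ : HFormula σ) :
    ψ.trace.fv ⊆ Prod.map some id '' ψ.fv ∪ {p | p.1 = none ∧ p.2 ∈ ψ.freeTraces} := by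
  induction ψ with
  | fo φ => exact φ.fv_trace
  | neg ψ ih => exact ih
  | ex π ψ ih | all π ψ ih =>
    rintro p ⟨hp, hp'⟩
    rcases ih hp with h | ⟨h1, h2⟩
    · exact Or.inl h
    · refine Or.inr ⟨h1, h2, fun h3 => hp' ?_⟩
      exact Prod.ext h1 h3

theorem HFormula.Closed.trace {ψ : HFormula σ} (h : ψ.Closed) : ψ.trace.Closed := by
  have := ψ.fv_trace
  rw [h.1, h.2] at this
  simpa [Formula.Closed, Set.subset_empty_iff] using this

end Trace

/-! ## Small models -/

section Relativized

variable {σ : Signature} {D : Domain σ}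

/-- Satisfaction with all quantifiers relativized to `S`. -/
def Formula.RHolds (S : ∀ s, Set (D.U s)) : Formula σ → Trace D → Val D → Prop
  | .eq t t', _, ν => t.eval ν = t'.eval ν
  | .rel R ts, τ, ν => ts.eval ν ∈ τ 0 R
  | .neg φ, τ, ν => ¬ φ.RHolds S τ ν
  | .or φ ψ, τ, ν => φ.RHolds S τ ν ∨ ψ.RHolds S τ ν
  | .and φ ψ, τ, ν => φ.RHolds S τ ν ∧ ψ.RHolds S τ ν
  | .ex s x φ, τ, ν => ∃ d ∈ S s, φ.RHolds S τ (ν.set s x d)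
  | .all s x φ, τ, ν => ∀ d ∈ S s, φ.RHolds S τ (ν.set s x d)
  | .next φ, τ, ν => φ.RHolds S (τ.drop 1) ν
  | .untl φ ψ, τ, ν => ∃ j, ψ.RHolds S (τ.drop j) ν ∧ ∀ k < j, φ.RHolds S (τ.drop k) ν
  | .release φ ψ, τ, ν =>
    ¬ ∃ j, ¬ ψ.RHolds S (τ.drop j) ν ∧ ∀ k < j, ¬ φ.RHolds S (τ.drop k) ν

theorem Formula.rHolds_univ (φ : Formula σ) (τ : Trace D) (ν : Val D) :
    φ.RHolds (fun _ => Set.univ) τ ν ↔ φ.Holds τ ν := by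
  induction φ generalizing τ ν with
  | eq | rel => rfl
  | neg φ ih | next φ ih => simp only [RHolds, Holds, ih]
  | or φ ψ ih1 ih2 | and φ ψ ih1 ih2 | untl φ ψ ih1 ih2 | release φ ψ ih1 ih2 =>
    simp only [RHolds, Holds, ih1, ih2]
  | ex s x φ ih | all s x φ ih => simp [RHolds, Holds, ih]

/-! ### Valuations: restricted values and dependence on finitely many variables -/

theorem Val.set_mem {S : ∀ s, Set (D.U s)} {ν : Val D} (h : ∀ s n, ν s n ∈ S s) {s : σ.Srt}
    {d : D.U s} (hd : d ∈ S s) (x : ℕ) (s' : σ.Srt) (n : ℕ) : ν.set s x d s' n ∈ S s' := by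
  by_cases hs : s' = s
  · subst hs
    rw [Val.set_self]
    by_cases hn : n = x
    · subst hn; simpa
    · simpa [hn] using h _ _
  · rw [Val.set_of_ne _ hs]
    exact h _ _

theorem Val.set_congr {ν ν' : Val D} {M : ℕ} (h : ∀ s, ∀ n < M, ν s n = ν' s n) (s : σ.Srt)
    (x : ℕ) (d : D.U s) (s' : σ.Srt) : ∀ n < M, ν.set s x d s' n = ν'.set s x d s' n := by
  intro n hn
  by_cases hs : s' = s
  · subst hs
    rw [Val.set_self, Val.set_self]
    by_cases hx : n = x
    · subst hx; simp
    · simpa [hx] using h _ _ hn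
  · rw [Val.set_of_ne _ hs, Val.set_of_ne _ hs]
    exact h _ _ hn

theorem Term.eval_congr {ν ν' : Val D} {M : ℕ} (h : ∀ s, ∀ n < M, ν s n = ν' s n) {s : σ.Srt}
    (t : Term σ s) (ht : t.code < M) : t.eval ν = t.eval ν' :=
  match t, ht with
  | .var _ n, ht => h _ _ ((Nat.right_le_pair 0 n).trans_lt ht)
  | .con _, _ => rfl

theorem Terms.eval_congr {ν ν' : Val D} {M : ℕ} (h : ∀ s, ∀ n < M, ν s n = ν' s n) :
    {l : List σ.Srt} → (ts : Terms σ l) → ts.code < M → ts.eval ν = ts.eval ν'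
  | _, .nil, _ => rfl
  | _, .cons t ts, hts => by
    simp only [Terms.code] at hts
    have h1 := Nat.left_le_pair t.code ts.code
    have h2 := Nat.right_le_pair t.code ts.code
    simp only [Terms.eval]
    rw [Term.eval_congr h t (by omega), Terms.eval_congr h ts (by omega)]

theorem left_lt_of_pair_pair_lt {a b c M : ℕ} (h : Nat.pair a (Nat.pair b c) < M) : b < M :=
  ((Nat.left_le_pair _ _).trans (Nat.right_le_pair _ _)).trans_lt h

theorem right_lt_of_pair_pair_lt {a b c M : ℕ} (h : Nat.pair a (Nat.pair b c) < M) : c < M :=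
  ((Nat.right_le_pair _ _).trans (Nat.right_le_pair _ _)).trans_lt h

theorem right_lt_of_pair_lt {a b M : ℕ} (h : Nat.pair a b < M) : b < M :=
  (Nat.right_le_pair _ _).trans_lt h

/-- The number of a variable in a formula is at most the code of the formula, so variables with
numbers from `M` on are irrelevant. -/
theorem Formula.rHolds_congr {S : ∀ s, Set (D.U s)} {M : ℕ} (φ : Formula σ) (hφ : φ.code < M)
    (τ : Trace D) {ν ν' : Val D} (h : ∀ s, ∀ n < M, ν s n = ν' s n) :
    φ.RHolds S τ ν ↔ φ.RHolds S τ ν' := by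
  induction φ generalizing τ ν ν' with
  | eq t t' =>
    have h1 := right_lt_of_pair_pair_lt hφ
    simp only [RHolds]
    rw [Term.eval_congr h t ((Nat.left_le_pair _ _).trans_lt h1),
      Term.eval_congr h t' ((Nat.right_le_pair _ _).trans_lt h1)]
  | rel R ts =>
    simp only [RHolds]
    rw [Terms.eval_congr h ts (right_lt_of_pair_pair_lt hφ)]
  | neg φ ih | next φ ih =>
    simp only [RHolds]
    rw [ih (right_lt_of_pair_lt hφ) _ h]
  | or φ ψ ih1 ih2 | and φ ψ ih1 ih2 | untl φ ψ ih1 ih2 | release φ ψ ih1 ih2 =>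
    simp only [RHolds, ih1 (left_lt_of_pair_pair_lt hφ) _ h, ih2 (right_lt_of_pair_pair_lt hφ) _ h]
  | ex s x φ ih | all s x φ ih =>
    simp only [RHolds, ih (right_lt_of_pair_pair_lt hφ) _ (Val.set_congr h s x _)]

/-- Universal formulas persist when the quantifiers range over fewer elements. Negation normal form
confines negation to atoms, where the two relations agree; all other connectives, the temporal ones
included, are monotone. -/
theorem Formula.rHolds_of_holds {S : ∀ s, Set (D.U s)} {φ : Formula σ} (hE : φ.ExFree)
    (hN : φ.IsNNF) (τ : Trace D) (ν : Val D) (h : φ.Holds τ ν) : φ.RHolds S τ ν := by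
  induction φ generalizing τ ν with
  | eq | rel => exact h
  | neg φ ih => cases φ <;> first | exact h | exact hN.elim
  | or φ ψ ih1 ih2 => exact h.imp (ih1 hE.1 hN.1 τ ν) (ih2 hE.2 hN.2 τ ν)
  | and φ ψ ih1 ih2 => exact h.imp (ih1 hE.1 hN.1 τ ν) (ih2 hE.2 hN.2 τ ν)
  | ex s x φ ih => exact hE.elim
  | all s x φ ih => exact fun d _ => ih hE hN τ _ (h d)
  | next φ ih => exact ih hE hN _ ν h
  | untl φ ψ ih1 ih2 =>
    obtain ⟨j, hj, hk⟩ := h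
    exact ⟨j, ih2 hE.2 hN.2 _ ν hj, fun k hkj => ih1 hE.1 hN.1 _ ν (hk k hkj)⟩
  | release φ ψ ih1 ih2 =>
    rintro ⟨j, hj, hk⟩
    exact h ⟨j, fun h' => hj (ih2 hE.2 hN.2 _ ν h'),
      fun k hkj h' => hk k hkj (ih1 hE.1 hN.1 _ ν h')⟩

/-! ### Stratified formulas and the collection of witnesses -/

/-- All existential quantifiers stand in a quantifier prefix, in which no existential quantifier
over a sort follows a universal quantifier over it, or is over one of the sorts in `F`. -/
inductive Formula.IsStratified : Set σ.Srt → Formula σ → Prop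
  | base {F : Set σ.Srt} {φ : Formula σ} (h : φ.ExFree) : IsStratified F φ
  | ex {F : Set σ.Srt} {s : σ.Srt} (x : ℕ) {φ : Formula σ} (hs : s ∉ F) (h : IsStratified F φ) :
    IsStratified F (.ex s x φ)
  | all {F : Set σ.Srt} (s : σ.Srt) (x : ℕ) {φ : Formula σ} (h : IsStratified (insert s F) φ) :
    IsStratified F (.all s x φ)

open Classical in
/-- Adds elements of one sort. -/
noncomputable def adjoin (S : ∀ s, Finset (D.U s)) (s : σ.Srt) (A : Finset (D.U s)) :
    ∀ s, Finset (D.U s) :=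
  Function.update S s (S s ∪ A)

theorem subset_adjoin (S : ∀ s, Finset (D.U s)) (s : σ.Srt) (A : Finset (D.U s)) (s' : σ.Srt) :
    S s' ⊆ adjoin S s A s' := by
  classical
  by_cases h : s' = s
  · subst h
    simpa only [adjoin, Function.update_self] using Finset.subset_union_left
  · simp [adjoin, h]

theorem mem_adjoin (S : ∀ s, Finset (D.U s)) (s : σ.Srt) {A : Finset (D.U s)} {d : D.U s}
    (h : d ∈ A) : d ∈ adjoin S s A s := by
  simp [adjoin, h]

theorem adjoin_of_ne (S : ∀ s, Finset (D.U s)) (s : σ.Srt) (A : Finset (D.U s)) {s' : σ.Srt}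
    (h : s' ≠ s) : adjoin S s A s' = S s' := by
  simp [adjoin, h]

theorem card_adjoin_le (S : ∀ s, Finset (D.U s)) (s : σ.Srt) (A : Finset (D.U s)) (s' : σ.Srt) :
    (adjoin S s A s').card ≤ (S s').card + A.card := by
  classical
  by_cases h : s' = s
  · subst h
    simpa only [adjoin, Function.update_self] using Finset.card_union_le _ _
  · simp [adjoin, h]

/-- One quantifier replaces `b` by `b * b`, and this is paid for by one more doubling of the
exponent. -/
theorem sq_pow_two_pow_le {b : ℕ} (hb : 2 ≤ b) {m n : ℕ} (h : m < n) :
    (b * b) ^ 2 ^ m ≤ b ^ 2 ^ n := by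
  rw [← sq, ← pow_mul, ← pow_succ']
  exact Nat.pow_le_pow_right (by omega) (Nat.pow_le_pow_right (by omega) h)

/-- Induction along the prefix with a finite family of valuations, one for each choice of values for
the universal variables met so far. An existential quantifier adjoins one witness per member of the
family; a universal one multiplies the family by `S s` and adds `s` to the set `F` of sorts that may
no longer grow. At the matrix no further elements are needed. -/
theorem Formula.IsStratified.exists_finset {τ : Trace D} {F : Set σ.Srt} {φ : Formula σ}
    (h : φ.IsStratified F) (hN : φ.IsNNF) {ι : Type} [Fintype ι] (ν : ι → Val D)
    (S : ∀ s, Finset (D.U s)) (hν : ∀ i s n, ν i s n ∈ S s) {b : ℕ} (hb : 2 ≤ b)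
    (hι : Fintype.card ι ≤ b) (hS : ∀ s, (S s).card ≤ b) (hφ : ∀ i, φ.Holds τ (ν i)) :
    ∃ S' : ∀ s, Finset (D.U s), (∀ s, S s ⊆ S' s) ∧ (∀ s ∈ F, S' s = S s) ∧
      (∀ s, (S' s).card ≤ b ^ 2 ^ φ.code) ∧
      ∀ i, φ.RHolds (fun s => (S' s : Set (D.U s))) τ (ν i) := by
  classical
  induction h generalizing ι S b with
  | @base F φ h =>
    exact ⟨S, fun s => subset_rfl, fun _ _ => rfl,
      fun s => (hS s).trans (Nat.le_self_pow (by positivity) b),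
      fun i => rHolds_of_holds h hN τ _ (hφ i)⟩
  | @ex F s x φ hs h ih =>
    choose d hd using hφ
    have hA : (Finset.univ.image d).card ≤ b := Finset.card_image_le.trans (by simpa)
    have hd' (i : ι) : d i ∈ adjoin S s (Finset.univ.image d) s := mem_adjoin S s (by simp)
    -- A set of at most `b` elements gains at most `b` witnesses, and `b + b ≤ b * b` because `2 ≤
    -- b`.
    obtain ⟨S', h1, h2, h3, h4⟩ := ih hN (fun i => (ν i).set s x (d i))
      (adjoin S s (Finset.univ.image d))
      (fun i => Val.set_mem (S := fun s' => (adjoin S s (Finset.univ.image d) s' : Set (D.U s')))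
        (fun s' n => subset_adjoin S s _ s' (hν i s' n)) (hd' i) x)
      (b := b * b) (by nlinarith) (by nlinarith)
      (fun s' => (card_adjoin_le S s _ s').trans (by have := hS s'; nlinarith)) hd
    refine ⟨S', fun s' => (subset_adjoin S s _ s').trans (h1 s'), fun s' hs' => ?_, fun s' => ?_,
      fun i => ⟨d i, h1 s (hd' i), h4 i⟩⟩
    · rw [h2 s' hs', adjoin_of_ne]
      rintro rfl
      exact hs hs'
    · exact (h3 s').trans (sq_pow_two_pow_le hb
        ((Nat.right_le_pair _ _).trans_lt (lt_pair_right (by norm_num) _)))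
  | @all F s x φ h ih =>
    obtain ⟨S', h1, h2, h3, h4⟩ := ih hN (ι := ι × S s) (fun i => (ν i.1).set s x i.2) S
      (fun i => Val.set_mem (S := fun s' => (S s' : Set (D.U s'))) (hν i.1) i.2.2 x)
      (b := b * b) (by nlinarith)
      (by rw [Fintype.card_prod, Fintype.card_coe]; exact Nat.mul_le_mul hι (hS s))
      (fun s' => (hS s').trans (by nlinarith)) (fun i => hφ i.1 i.2)
    refine ⟨S', h1, fun s' hs' => h2 s' (Set.mem_insert_of_mem _ hs'), fun s' => ?_,
      fun i d hd => ?_⟩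
    · exact (h3 s').trans (sq_pow_two_pow_le hb
        ((Nat.right_le_pair _ _).trans_lt (lt_pair_right (by norm_num) _)))
    -- As `s` was frozen, `S' s` is still `S s`, so every instance to be checked already belongs to
    -- the family.
    · rw [Finset.mem_coe, h2 s (Set.mem_insert _ _)] at hd
      exact h4 (i, ⟨d, hd⟩)

theorem Formula.IsStratified.exists_small [Fintype σ.Con] {φ : Formula σ}
    (h : φ.IsStratified ∅) (hN : φ.IsNNF) {M : ℕ} (hM : φ.code < M)
    (hc : Fintype.card σ.Con ≤ M) {τ : Trace D} {ν : Val D} (hφ : φ.Holds τ ν) :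
    ∃ (ν' : Val D) (S : ∀ s, Finset (D.U s)), (∀ s n, ν' s n ∈ S s) ∧
      (∀ c, D.con c ∈ S (σ.conSort c)) ∧ (∀ s, (S s).card ≤ (2 * M) ^ 2 ^ M) ∧
      φ.RHolds (fun s => (S s : Set (D.U s))) τ ν' := by
  classical
  -- Variables that cannot occur in `φ` get the value of variable 0, so that only `M` values per
  -- sort are used; with the at most `M` constants this gives the starting bound `2 * M`.
  let ν' : Val D := fun s n => if n < M then ν s n else ν s 0
  let S : ∀ s, Finset (D.U s) := fun s => (Finset.range M).image (ν s) ∪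
    (Finset.univ : Finset {c // σ.conSort c = s}).image
      (fun c : {c // σ.conSort c = s} => (c.2 ▸ D.con c.1 : D.U s))
  have hν' (s : σ.Srt) (n : ℕ) : ν' s n ∈ S s := by
    refine Finset.mem_union_left _ (Finset.mem_image.2 ?_)
    by_cases hn : n < M
    · exact ⟨n, by simpa using hn, by simp [ν', hn]⟩
    · exact ⟨0, by simp; omega, by simp [ν', hn]⟩
  have hS (s : σ.Srt) : (S s).card ≤ 2 * M := by
    refine (Finset.card_union_le _ _).trans ?_
    have h1 : ((Finset.range M).image (ν s)).card ≤ M := Finset.card_image_le.trans (by simp)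
    have h2 : ((Finset.univ : Finset {c // σ.conSort c = s}).image
        (fun c : {c // σ.conSort c = s} => (c.2 ▸ D.con c.1 : D.U s))).card ≤ M :=
      Finset.card_image_le.trans ((Fintype.card_subtype_le _).trans hc)
    omega
  have hφ' : φ.Holds τ ν' := by
    rw [← rHolds_univ] at hφ ⊢
    exact (rHolds_congr φ hM τ (fun s n hn => by simp [ν', hn])).2 hφ
  obtain ⟨S', h1, -, h3, h4⟩ := h.exists_finset hN (ι := Unit) (fun _ => ν') S (fun _ => hν')
    (b := 2 * M) (by omega) (by simp; omega) hS (fun _ => hφ')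
  refine ⟨ν', S', fun s n => h1 s (hν' s n), fun c => h1 _ ?_, fun s => (h3 s).trans ?_, h4 ()⟩
  · exact Finset.mem_union_right _ (Finset.mem_image.2 ⟨⟨c, rfl⟩, Finset.mem_univ _, rfl⟩)
  · exact Nat.pow_le_pow_right (by omega) (Nat.pow_le_pow_right (by omega) hM.le)

end Relativized

/-! ## The fragment is stratified -/

section Fragment

variable {σ : Signature}

theorem Formula.IsExPrefix.exFree {φ : Formula σ} (h : φ.IsExPrefix)
    (h' : ∀ s x ψ, φ ≠ .ex s x ψ) : φ.ExFree := by
  cases h with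
  | base h => exact h
  | ex s x h => exact (h' s x _ rfl).elim

/-- An existential quantifier over `s` survives in the projection on `s`. -/
theorem Formula.exFree_of_proj {φ : Formula σ} (h : ∀ s, (φ.proj s).ExFree) :
    φ.ExFree := by
  induction φ with
  | eq | rel => trivial
  | neg φ ih | next φ ih => exact ih h
  | or φ ψ ih1 ih2 | and φ ψ ih1 ih2 | untl φ ψ ih1 ih2 | release φ ψ ih1 ih2 =>
    exact ⟨ih1 fun s => (h s).1, ih2 fun s => (h s).2⟩
  | ex s x φ ih => simpa [proj, ExFree] using h s
  | all s x φ ih =>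
    refine ih fun s' => ?_
    have := h s'
    by_cases hs : s = s' <;> simpa [proj, hs, ExFree] using this

/-- A connective at the root is the root of every projection and ends all existential prefixes at
once. A universal quantifier over `s` ends only the one of the projection on `s`, which is why `s`
joins `F` and the other sorts continue. -/
theorem Formula.isStratified_of_proj {φ : Formula σ} {F : Set σ.Srt}
    (hF : ∀ s ∈ F, (φ.proj s).ExFree) (h : ∀ s, (φ.proj s).IsExPrefix) : φ.IsStratified F := by
  induction φ generalizing F with
  | eq | rel => exact .base trivial
  | neg φ | next φ | or φ ψ | and φ ψ | untl φ ψ | release φ ψ =>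
    exact .base (exFree_of_proj fun s => (h s).exFree (by simp [proj]))
  | ex s x φ ih =>
    refine .ex x (fun hs => by simpa [proj, ExFree] using hF s hs)
      (ih (fun s' hs' => ?_) fun s' => ?_)
    · have := hF s' hs'
      by_cases hs : s = s'
      · simp [proj, hs, ExFree] at this
      · simpa [proj, hs] using this
    · have := h s'
      by_cases hs : s = s'
      · simp only [proj, hs, if_true] at this
        cases this with
        | base h => exact h.elim
        | ex _ _ h => exact h
      · simpa [proj, hs] using this
  | all s x φ ih =>
    have hs : (φ.proj s).ExFree := by
      have := (h s).exFree (by simp [proj])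
      simpa [proj, ExFree] using this
    refine .all s x (ih (fun s' hs' => ?_) fun s' => ?_)
    · rcases hs' with rfl | hs'
      · exact hs
      · have := hF s' hs'
        by_cases hss : s = s' <;> simpa [proj, hss, ExFree] using this
    · by_cases hss : s = s'
      · subst hss
        exact .base hs
      · have := h s'
        simpa [proj, hss] using this

theorem Formula.ExFree.trace {φ : Formula σ.hyper} (h : φ.ExFree) : φ.trace.ExFree := by
  induction φ with
  | eq | rel => trivial
  | neg φ ih | next φ ih | all s x φ ih => exact ih h
  | or φ ψ ih1 ih2 | and φ ψ ih1 ih2 | untl φ ψ ih1 ih2 | release φ ψ ih1 ih2 =>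
    exact ⟨ih1 h.1, ih2 h.2⟩
  | ex s x φ ih => exact h.elim

theorem Formula.IsNNF.trace {φ : Formula σ.hyper} (h : φ.IsNNF) : φ.trace.IsNNF := by
  induction φ with
  | eq | rel => trivial
  | next φ ih | all s x φ ih | ex s x φ ih => exact ih h
  | or φ ψ ih1 ih2 | and φ ψ ih1 ih2 | untl φ ψ ih1 ih2 | release φ ψ ih1 ih2 =>
    exact ⟨ih1 h.1, ih2 h.2⟩
  | neg φ ih => cases φ <;> trivial

theorem Formula.IsStratified.mono {F F' : Set σ.Srt} {φ : Formula σ} (h : φ.IsStratified F)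
    (hF : F' ⊆ F) : φ.IsStratified F' := by
  induction h generalizing F' with
  | base h => exact .base h
  | ex x hs h ih => exact .ex x (fun h' => hs (hF h')) (ih hF)
  | all s x h ih => exact .all s x (ih (Set.insert_subset_insert hF))

theorem Formula.isStratified_ex {F : Set σ.Srt} {s : σ.Srt} {x : ℕ} {φ : Formula σ}
    (h : (Formula.ex s x φ).IsStratified F) : s ∉ F ∧ φ.IsStratified F := by
  cases h with
  | base h => exact h.elim
  | ex _ hs h => exact ⟨hs, h⟩

theorem Formula.isStratified_all {F : Set σ.Srt} {s : σ.Srt} {x : ℕ} {φ : Formula σ}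
    (h : (Formula.all s x φ).IsStratified F) :
    (Formula.all s x φ).ExFree ∨ φ.IsStratified (insert s F) := by
  cases h with
  | base h => exact .inl h
  | all _ _ h => exact .inr h

theorem Formula.IsStratified.exFree {F : Set σ.Srt} {φ : Formula σ} (h : φ.IsStratified F)
    (h1 : ∀ s x ψ, φ ≠ .ex s x ψ) (h2 : ∀ s x ψ, φ ≠ .all s x ψ) : φ.ExFree := by
  cases h with
  | base h => exact h
  | ex _ _ h => exact (h1 _ _ _ rfl).elim
  | all _ _ h => exact (h2 _ _ _ rfl).elim

/-- The encoded first-order part never quantifies over the trace sort, so that sort counts as frozen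
at no cost. This leaves room for the universal trace quantifiers in front. -/
theorem Formula.IsStratified.trace {F : Set σ.Srt} {φ : Formula σ.hyper}
    (h : IsStratified (σ := σ.hyper) F φ) :
    IsStratified (σ := σ.trace) (insert none (some '' F)) φ.trace := by
  induction φ generalizing F with
  | ex s x φ ih =>
    obtain ⟨hs, h⟩ := Formula.isStratified_ex h
    exact .ex x (by simpa using hs) (ih h)
  | all s x φ ih =>
    rcases Formula.isStratified_all h with h | h
    · exact .base (Formula.ExFree.trace (φ := .all s x φ) h)
    · refine .all _ x ?_
      have := ih h
      rwa [Set.image_insert_eq, Set.insert_comm] at this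
  | _ => exact .base (Formula.ExFree.trace (Formula.IsStratified.exFree h (by simp) (by simp)))

theorem HFormula.IsExAllBS.trace {ψ : HFormula σ} (h : ψ.IsExAllBS) :
    ψ.trace.IsStratified ∅ ∧ ψ.trace.IsNNF := by
  obtain ⟨πs, πs', φ, ⟨-, hN, hp⟩, rfl⟩ := h
  have hφ : Formula.IsStratified (σ := σ.trace) {none} φ.trace := by
    have := Formula.IsStratified.trace (σ := σ)
      (Formula.isStratified_of_proj (F := ∅) (by simp) hp)
    simpa using this
  have hall : Formula.IsStratified (σ := σ.trace) {none}
        (πs'.foldr HFormula.all (HFormula.fo φ)).trace ∧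
      (πs'.foldr HFormula.all (HFormula.fo φ)).trace.IsNNF := by
    induction πs' with
    | nil => exact ⟨hφ, Formula.IsNNF.trace hN⟩
    | cons π πs' ih => exact ⟨.all _ π (ih.1.mono (by simp)), ih.2⟩
  induction πs with
  | nil => exact ⟨hall.1.mono (by simp), hall.2⟩
  | cons π πs ih => exact ⟨.ex π (by simp) ih.1, ih.2⟩

end Fragment

/-! ## Semantics of formula codes over the natural numbers

The universe of the sort with code `s` is `{0, …, z s}`, the value of the constant with code `c`
is `k c`, capped at the largest element of the universe, `ar R` lists the codes of the argument
sorts of the relation with code `R`, and `P i R` is the interpretation of `R` at time `i`. The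
value of the variable `(s, n)` is `w (Nat.pair s n)`, capped at `z s`. -/

def termValue (z k w : ℕ → ℕ) (s t : ℕ) : ℕ :=
  min (if t.unpair.1 = 0 then w (Nat.pair s t.unpair.2) else k t.unpair.2) (z s)

def termsValue (z k w : ℕ → ℕ) (l ts : List ℕ) : List ℕ :=
  (List.range l.length).map fun j => termValue z k w (l.getD j 0) (ts.getD j 0)

/-- The satisfaction relation on formula codes, with `r` for the recursive calls. -/
def codeHoldsBody (z k : ℕ → ℕ) (ar : ℕ → List ℕ) (P : ℕ → ℕ → List ℕ → Prop) (c : ℕ)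
    (r : ℕ → ℕ → (ℕ → ℕ) → Prop) (i : ℕ) (w : ℕ → ℕ) : Prop :=
  if c.unpair.1 = 1 then
    termValue z k w c.unpair.2.unpair.1 c.unpair.2.unpair.2.unpair.1 =
      termValue z k w c.unpair.2.unpair.1 c.unpair.2.unpair.2.unpair.2
  else if c.unpair.1 = 2 then
    P i c.unpair.2.unpair.1 (termsValue z k w (ar c.unpair.2.unpair.1)
      (decodeD [] c.unpair.2.unpair.2))
  else if c.unpair.1 = 3 then ¬ r c.unpair.2 i w
  else if c.unpair.1 = 4 then r c.unpair.2.unpair.1 i w ∨ r c.unpair.2.unpair.2 i w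
  else if c.unpair.1 = 5 then r c.unpair.2.unpair.1 i w ∧ r c.unpair.2.unpair.2 i w
  else if c.unpair.1 = 6 then
    ∃ d < z c.unpair.2.unpair.1.unpair.1 + 1,
      r c.unpair.2.unpair.2 i (Function.update w c.unpair.2.unpair.1 d)
  else if c.unpair.1 = 7 then
    ∀ d < z c.unpair.2.unpair.1.unpair.1 + 1,
      r c.unpair.2.unpair.2 i (Function.update w c.unpair.2.unpair.1 d)
  else if c.unpair.1 = 8 then r c.unpair.2 (i + 1) w
  else if c.unpair.1 = 9 then
    ∃ j, r c.unpair.2.unpair.2 (i + j) w ∧ ∀ m < j, r c.unpair.2.unpair.1 (i + m) w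
  else if c.unpair.1 = 10 then
    ¬ ∃ j, ¬ r c.unpair.2.unpair.2 (i + j) w ∧ ∀ m < j, ¬ r c.unpair.2.unpair.1 (i + m) w
  else False

/-- The satisfaction relation on formula codes. -/
def CodeHolds (z k : ℕ → ℕ) (ar : ℕ → List ℕ) (P : ℕ → ℕ → List ℕ → Prop) (c : ℕ) :
    ℕ → (ℕ → ℕ) → Prop :=
  codeHoldsBody z k ar P c (fun c' i w => if _ : c' < c then CodeHolds z k ar P c' i w else False)
termination_by c

/-- The codes of the members of a tuple of terms. -/
def Terms.codes {σ : Signature} {l : List σ.Srt} : Terms σ l → List ℕ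
  | .nil => []
  | .cons t ts => t.code :: ts.codes

theorem Terms.encode_codes {σ : Signature} : {l : List σ.Srt} → (ts : Terms σ l) →
    Encodable.encode ts.codes = ts.code
  | _, .nil => rfl
  | _, .cons t ts => by simp [Terms.codes, Terms.code, Terms.encode_codes ts]

/-- The tuple that is named by a list of natural numbers. -/
def Tuple.ofList {S : Type} {U : S → Type} (f : ∀ s, ℕ → U s) : (l : List S) → List ℕ → Tuple U l
  | [], _ => ()
  | s :: l, xs => (f s (xs.headD 0), Tuple.ofList f l xs.tail)

section Interpretation

variable {σ : Signature} {D : Domain σ}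

/-- The valuation that corresponds to `w`, when `f s` enumerates the sort `s`. -/
def Val.ofNat (f : ∀ s, ℕ → D.U s) (z w : ℕ → ℕ) : Val D :=
  fun s n => f s (min (w (Nat.pair (Encodable.encode s) n)) (z (Encodable.encode s)))

theorem Val.ofNat_update (f : ∀ s, ℕ → D.U s) (z w : ℕ → ℕ) (s : σ.Srt) (x d : ℕ)
    (hd : d < z (Encodable.encode s) + 1) :
    Val.ofNat f z (Function.update w (Nat.pair (Encodable.encode s) x) d) =
      (Val.ofNat f z w).set s x (f s d) := by
  funext s' n
  by_cases hs : s' = s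
  · subst hs
    rw [Val.set_self]
    by_cases hn : n = x
    · subst hn
      simp [Val.ofNat, Nat.lt_succ_iff.1 hd]
    · simp [Val.ofNat, hn, Nat.pair_eq_pair]
  · rw [Val.set_of_ne _ hs]
    simp [Val.ofNat, Nat.pair_eq_pair, hs]

/-- `f s` restricts to a bijection from the universe `{0, …, z s}` to `S s`, and the constants
correspond to each other. -/
structure IsEnumeration (D : Domain σ) (S : ∀ s, Set (D.U s)) (f : ∀ s, ℕ → D.U s)
    (z k : ℕ → ℕ) : Prop where
  mem : ∀ s d, d ≤ z (Encodable.encode s) → f s d ∈ S s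
  inj : ∀ s d d', d ≤ z (Encodable.encode s) → d' ≤ z (Encodable.encode s) → f s d = f s d' → d = d'
  surj : ∀ s, ∀ u ∈ S s, ∃ d ≤ z (Encodable.encode s), f s d = u
  con : ∀ c, D.con c =
    f (σ.conSort c) (min (k (Encodable.encode c)) (z (Encodable.encode (σ.conSort c))))

variable {S : ∀ s, Set (D.U s)} {f : ∀ s, ℕ → D.U s} {z k : ℕ → ℕ}

theorem IsEnumeration.eval_term (h : IsEnumeration D S f z k) (w : ℕ → ℕ) {s : σ.Srt}
    (t : Term σ s) :
    t.eval (Val.ofNat f z w) = f s (termValue z k w (Encodable.encode s) t.code) :=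
  match s, t with
  | _, .var _ _ => by simp [Term.eval, Val.ofNat, termValue, Term.code]
  | _, .con c => by simp [Term.eval, termValue, Term.code, h.con]

theorem termsValue_cons (z k w : ℕ → ℕ) (s t : ℕ) (l ts : List ℕ) :
    termsValue z k w (s :: l) (t :: ts) = termValue z k w s t :: termsValue z k w l ts := by
  simp [termsValue, List.range_succ_eq_map, Function.comp_def]

theorem IsEnumeration.eval_terms (h : IsEnumeration D S f z k) (w : ℕ → ℕ) : {l : List σ.Srt} →
    (ts : Terms σ l) → ts.eval (Val.ofNat f z w) =
      Tuple.ofList f l (termsValue z k w (l.map Encodable.encode) ts.codes)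
  | _, .nil => rfl
  | _, .cons t ts => by
    simp only [Terms.eval, Terms.codes, List.map_cons, termsValue_cons, Tuple.ofList,
      h.eval_term w t, h.eval_terms w ts]
    rfl

/-- The list names a tuple. -/
def IsValid (z : ℕ → ℕ) (l : List σ.Srt) (xs : List ℕ) : Prop :=
  List.Forall₂ (fun s d => d ≤ z (Encodable.encode s)) l xs

theorem isValid_termsValue (z k w : ℕ → ℕ) : {l : List σ.Srt} → (ts : Terms σ l) →
    IsValid z l (termsValue z k w (l.map Encodable.encode) ts.codes)
  | _, .nil => .nil
  | _, .cons t ts => by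
    simp only [Terms.codes, List.map_cons, termsValue_cons]
    exact .cons (min_le_right _ _) (isValid_termsValue z k w ts)

/-- The relations need to correspond only on lists that name tuples, because capping makes every
evaluated argument list one of these. -/
theorem IsEnumeration.codeHolds_iff (h : IsEnumeration D S f z k) {ar : ℕ → List ℕ}
    (har : ∀ R, ar (Encodable.encode R) = (σ.arity R).map Encodable.encode)
    {P : ℕ → ℕ → List ℕ → Prop} {τ : Trace D}
    (hP : ∀ i R xs, IsValid z (σ.arity R) xs →
      (P i (Encodable.encode R) xs ↔ Tuple.ofList f (σ.arity R) xs ∈ τ i R))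
    (φ : Formula σ) (i : ℕ) (w : ℕ → ℕ) :
    CodeHolds z k ar P φ.code i w ↔ φ.RHolds S (τ.drop i) (Val.ofNat f z w) := by
  have h1 : ∀ a b, 1 ≤ a → b < Nat.pair a b := fun a b h => lt_pair_right h b
  have hl : ∀ {a b c}, 1 ≤ a → b < Nat.pair a (Nat.pair b c) := fun h =>
    (Nat.left_le_pair _ _).trans_lt (lt_pair_right h _)
  have hr : ∀ {a b c}, 1 ≤ a → c < Nat.pair a (Nat.pair b c) := fun h =>
    (Nat.right_le_pair _ _).trans_lt (lt_pair_right h _)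
  induction φ generalizing i w with
  | @eq s t t' =>
    rw [CodeHolds]
    simp only [codeHoldsBody, Formula.code, Nat.unpair_pair, if_true, Formula.RHolds,
      h.eval_term w]
    -- Equality atoms are what forces the enumeration to be injective on the capped range.
    exact ⟨fun e => by rw [e], fun e => h.inj s _ _ (min_le_right _ _) (min_le_right _ _) e⟩
  | rel R ts =>
    rw [CodeHolds]
    simp only [codeHoldsBody, Formula.code, Nat.unpair_pair, Formula.RHolds, h.eval_terms w,
      ← Terms.encode_codes, decodeD_encode, har]
    simpa [Trace.drop] using hP i R _ (isValid_termsValue z k w ts)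
  | neg φ ih =>
    rw [CodeHolds]
    simp [codeHoldsBody, Formula.code, h1, ih, Formula.RHolds]
  | or φ ψ ih1 ih2 | and φ ψ ih1 ih2 =>
    rw [CodeHolds]
    simp [codeHoldsBody, Formula.code, hl, hr, ih1, ih2, Formula.RHolds]
  | next φ ih =>
    rw [CodeHolds]
    simp [codeHoldsBody, Formula.code, h1, ih, Formula.RHolds, Trace.drop_drop]
  | untl φ ψ ih1 ih2 | release φ ψ ih1 ih2 =>
    rw [CodeHolds]
    simp [codeHoldsBody, Formula.code, hl, hr, ih1, ih2, Formula.RHolds, Trace.drop_drop]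
  | ex s x φ ih =>
    rw [CodeHolds]
    simp only [codeHoldsBody, Formula.code, Nat.unpair_pair, ih, Formula.RHolds]
    simp only [OfNat.ofNat_ne_one, Nat.reduceEqDiff, if_false, if_true,
      Nat.one_le_ofNat, dite_true, hr]
    constructor
    · rintro ⟨d, hd, hφ⟩
      rw [Val.ofNat_update f z w s x d hd] at hφ
      exact ⟨f s d, h.mem s d (Nat.lt_succ_iff.1 hd), hφ⟩
    · rintro ⟨u, hu, hφ⟩
      obtain ⟨d, hd, rfl⟩ := h.surj s u hu
      refine ⟨d, Nat.lt_succ_iff.2 hd, ?_⟩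
      rwa [Val.ofNat_update f z w s x d (Nat.lt_succ_iff.2 hd)]
  | all s x φ ih =>
    rw [CodeHolds]
    simp only [codeHoldsBody, Formula.code, Nat.unpair_pair, ih, Formula.RHolds]
    simp only [OfNat.ofNat_ne_one, Nat.reduceEqDiff, if_false, if_true,
      Nat.one_le_ofNat, dite_true, hr]
    constructor
    · intro hφ u hu
      obtain ⟨d, hd, rfl⟩ := h.surj s u hu
      rw [← Val.ofNat_update f z w s x d (Nat.lt_succ_iff.2 hd)]
      exact hφ d (Nat.lt_succ_iff.2 hd)
    · intro hφ d hd
      rw [Val.ofNat_update f z w s x d hd]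
      exact hφ _ (h.mem s d (Nat.lt_succ_iff.1 hd))

end Interpretation

section Translation

variable {σ : Signature}

/-- The list that names a tuple over the universes `{0, …, z s}`. -/
def Tuple.toList {S : Type} {z : S → ℕ} : {l : List S} → Tuple (fun s => Fin (z s + 1)) l → List ℕ
  | [], _ => []
  | _ :: _, (u, us) => u.val :: Tuple.toList us

theorem toList_ofList {z : ℕ → ℕ} {l : List σ.Srt} {xs : List ℕ} (h : IsValid z l xs) :
    Tuple.toList (Tuple.ofList (U := fun s => Fin (z (Encodable.encode s) + 1))
      (fun _ d => Fin.ofNat _ d) l xs) = xs := by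
  induction h with
  | nil => rfl
  | cons hd _ ih =>
    simp only [Tuple.ofList, Tuple.toList, List.headD_cons, List.tail_cons, ih]
    simp [Nat.mod_eq_of_lt (Nat.lt_succ_iff.2 hd)]

/-- The initial segments `{0, …, z s}` are taken as universes; they are non-empty for every `z`, so
arbitrary parameters give a structure. -/
theorem Formula.satisfiable_of_codeHolds (φ : Formula σ) {z k : ℕ → ℕ} {ar : ℕ → List ℕ}
    (har : ∀ R, ar (Encodable.encode R) = (σ.arity R).map Encodable.encode)
    {P : ℕ → ℕ → List ℕ → Prop} {w : ℕ → ℕ} (hφ : CodeHolds z k ar P φ.code 0 w) :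
    φ.Satisfiable := by
  let D : Domain σ :=
    { U := fun s => Fin (z (Encodable.encode s) + 1)
      nonempty := fun _ => inferInstance
      con := fun c => Fin.ofNat _
        (min (k (Encodable.encode c)) (z (Encodable.encode (σ.conSort c)))) }
  let f : ∀ s, ℕ → D.U s := fun s d => Fin.ofNat (z (Encodable.encode s) + 1) d
  have hD : IsEnumeration D (fun _ => Set.univ) f z k :=
    { mem := fun _ _ _ => trivial
      inj := fun s d d' hd hd' e => by
        have := congrArg Fin.val e
        simpa [f, Nat.mod_eq_of_lt (Nat.lt_succ_iff.2 hd),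
          Nat.mod_eq_of_lt (Nat.lt_succ_iff.2 hd')] using this
      surj := fun s u _ => ⟨u.val, Nat.lt_succ_iff.1 u.isLt,
        Fin.ext (Nat.mod_eq_of_lt u.isLt)⟩
      con := fun _ => rfl }
  let τ : Trace D := fun i R => {us | P i (Encodable.encode R) (Tuple.toList us)}
  refine ⟨D, τ, Val.ofNat f z w, ?_⟩
  rw [← rHolds_univ]
  have e : τ.drop 0 = τ := by funext i; simp [Trace.drop]
  have h := (hD.codeHolds_iff (τ := τ) har (fun i R xs hxs => ?_) φ 0 w).1 hφ
  · rwa [e] at h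
  · change _ ↔ P i _ (Tuple.toList (Tuple.ofList f _ xs))
    rw [toList_ofList hxs]

/-- Each finite set `S s` is numbered by `Finset.equivFin`. The parameters are bounded by `N` and
vanish outside a finite range, so that each can later be stored as the base-`N` digits of one
number. -/
theorem Formula.exists_codeHolds {D : Domain σ} {S : ∀ s, Finset (D.U s)} {τ : Trace D}
    {ν : Val D} {M N : ℕ} {φ : Formula σ} (hM : φ.code < M)
    (hs : ∀ s : σ.Srt, Encodable.encode s < M)
    (hc : ∀ c : σ.Con, Encodable.encode c < M) {ar : ℕ → List ℕ}
    (har : ∀ R, ar (Encodable.encode R) = (σ.arity R).map Encodable.encode)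
    (hν : ∀ s n, ν s n ∈ S s) (hcon : ∀ c, D.con c ∈ S (σ.conSort c))
    (hS : ∀ s, (S s).card ≤ N) (hN : 0 < N)
    (hφ : φ.RHolds (fun s => (S s : Set (D.U s))) τ ν) :
    ∃ (z k w : ℕ → ℕ) (P : ℕ → ℕ → List ℕ → Prop), (∀ n, z n < N) ∧ (∀ n ≥ M, z n = 0) ∧
      (∀ n, k n < N) ∧ (∀ n ≥ M, k n = 0) ∧ (∀ n, w n < N) ∧ (∀ n ≥ Nat.pair M M, w n = 0) ∧
      CodeHolds z k ar P φ.code 0 w := by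
  classical
  have hpos (s) : 0 < (S s).card := Finset.card_pos.2 ⟨_, hν s 0⟩
  let z : ℕ → ℕ := fun n => if n < M then
    (Encodable.decode (α := σ.Srt) n).elim 0 (fun s => (S s).card - 1) else 0
  have hz (s : σ.Srt) : z (Encodable.encode s) + 1 = (S s).card := by
    have := hpos s
    simp [z, hs s]
    omega
  let f : ∀ s, ℕ → D.U s := fun s d =>
    if h : d < (S s).card then ((S s).equivFin.symm ⟨d, h⟩).1 else ν s 0
  have hmem (s d) : f s d ∈ S s := by
    by_cases h : d < (S s).card
    · simp [f, h]
    · simp only [f, h, dite_false, hν]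
  have hsurj (s) (u) (hu : u ∈ S s) : ∃ d ≤ z (Encodable.encode s), f s d = u := by
    refine ⟨((S s).equivFin ⟨u, hu⟩).1, ?_, by simp [f]⟩
    have := ((S s).equivFin ⟨u, hu⟩).2
    have := hz s
    omega
  choose! g hg hfg using hsurj
  let k : ℕ → ℕ := fun n => if n < M then
    (Encodable.decode (α := σ.Con) n).elim 0 (fun c => g (σ.conSort c) (D.con c)) else 0
  let w : ℕ → ℕ := fun n => if n.unpair.1 < M ∧ n.unpair.2 < M then
    (Encodable.decode (α := σ.Srt) n.unpair.1).elim 0 (fun s => g s (ν s n.unpair.2)) else 0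
  have hgN (s) (u) (hu : u ∈ S s) : g s u < N := by
    have := hg s u hu
    have := hz s
    have := hS s
    omega
  have hD : IsEnumeration D (fun s => (S s : Set (D.U s))) f z k :=
    { mem := fun s d _ => hmem s d
      inj := fun s d d' hd hd' e => by
        have h1 : d < (S s).card := by have := hz s; omega
        have h2 : d' < (S s).card := by have := hz s; omega
        simpa [f, h1, h2, Subtype.val_inj] using e
      surj := fun s u hu => ⟨g s u, hg s u hu, hfg s u hu⟩
      con := fun c => by
        simp only [k, hc, if_true, Encodable.encodek, Option.elim_some]
        rw [min_eq_left (hg _ _ (hcon c)), hfg _ _ (hcon c)] }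
  let P : ℕ → ℕ → List ℕ → Prop := fun i r xs =>
    ∃ R : σ.Rel, Encodable.encode R = r ∧ Tuple.ofList f (σ.arity R) xs ∈ τ i R
  refine ⟨z, k, w, P, fun n => ?_, fun n hn => by simp [z]; omega, fun n => ?_,
    fun n hn => by simp [k]; omega, fun n => ?_, fun n hn => ?_, ?_⟩
  · by_cases hn : n < M
    · cases hd : Encodable.decode (α := σ.Srt) n with
      | none => simpa [z, hd]
      | some s =>
        have := hpos s
        have := hS s
        simp [z, hn, hd]
        omega
    · simpa [z, hn]
  · by_cases hn : n < M
    · cases hd : Encodable.decode (α := σ.Con) n with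
      | none => simpa [k, hd]
      | some c => simpa [k, hn, hd] using hgN _ _ (hcon c)
    · simpa [k, hn]
  · by_cases hn : n.unpair.1 < M ∧ n.unpair.2 < M
    · cases hd : Encodable.decode (α := σ.Srt) n.unpair.1 with
      | none => simpa [w, hd]
      | some s => simpa [w, hn, hd] using hgN _ _ (hν s _)
    · simpa [w, hn]
  · refine if_neg fun h => ?_
    have h1 := Nat.pair_lt_pair_left n.unpair.2 h.1
    have h2 := Nat.pair_lt_pair_right M h.2
    rw [Nat.pair_unpair] at h1
    omega
  · refine (hD.codeHolds_iff (τ := τ) har (fun i R xs _ => ⟨?_, fun h => ⟨R, rfl, h⟩⟩) φ 0 w).2 ?_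
    · rintro ⟨R', e, h⟩
      obtain rfl := Encodable.encode_injective e
      exact h
    · have e : τ.drop 0 = τ := by funext i; simp [Trace.drop]
      rw [e]
      refine (φ.rHolds_congr hM τ fun s n hn => ?_).1 hφ
      simp only [Val.ofNat, w, Nat.unpair_pair, hs, hn, and_self, if_true, Encodable.encodek,
        Option.elim_some]
      rw [min_eq_left (hg _ _ (hν s n)), hfg _ _ (hν s n)]

end Translation

/-! ## Finite functions and finite sets as natural numbers -/

/-- The digit with index `n` of `v` in base `b`. -/
def digit (b v n : ℕ) : ℕ := v / b ^ n % b

/-- The bit with index `n` of `t` is set. -/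
def Bit (t n : ℕ) : Prop := digit 2 t n = 1

theorem digit_lt {b : ℕ} (hb : 0 < b) (v n : ℕ) : digit b v n < b := Nat.mod_lt _ hb

theorem digit_eq_zero {b v L n : ℕ} (hv : v < b ^ L) (hn : L ≤ n) : digit b v n = 0 := by
  have hb : 0 < b ∨ b = 0 := by omega
  rcases hb with hb | rfl
  · rw [digit, Nat.div_eq_of_lt (hv.trans_le (Nat.pow_le_pow_right hb hn)), Nat.zero_mod]
  · rcases n with _ | n
    · obtain rfl : L = 0 := by omega
      simp only [pow_zero, Nat.lt_one_iff] at hv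
      simp [digit, hv]
    · simp [digit]

theorem exists_digit {b L : ℕ} (f : ℕ → ℕ) (hf : ∀ n, f n < b) (hL : ∀ n ≥ L, f n = 0) :
    ∃ v < b ^ L, digit b v = f := by
  have hb : 0 < b := (Nat.zero_le _).trans_lt (hf 0)
  let u := finFunctionFinEquiv (fun i : Fin L => (⟨f i, hf i⟩ : Fin b))
  refine ⟨u.1, u.2, funext fun n => ?_⟩
  by_cases hn : n < L
  · have := finFunctionFinEquiv_symm_apply_val u ⟨n, hn⟩
    simp only [u, Equiv.symm_apply_apply] at this
    exact this.symm
  · rw [digit_eq_zero u.2 (not_lt.1 hn), hL n (not_lt.1 hn)]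

theorem exists_bit {L : ℕ} (p : ℕ → Prop) (hL : ∀ n, p n → n < L) :
    ∃ t < 2 ^ L, ∀ n, Bit t n ↔ p n := by
  classical
  obtain ⟨t, ht, h⟩ := exists_digit (b := 2) (L := L) (fun n => if p n then 1 else 0)
    (fun n => by split_ifs <;> norm_num)
    (fun n hn => if_neg fun h => absurd (hL n h) (not_lt.2 hn))
  refine ⟨t, ht, fun n => ?_⟩
  rw [Bit, h]
  simp

theorem digit_eq_update {N L v v' n d : ℕ} (hv : v < N ^ L) (hv' : v' < N ^ L) (hn : n < L)
    (h : ∀ i < L, digit N v' i = if i = n then d else digit N v i) :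
    digit N v' = Function.update (digit N v) n d := by
  funext i
  by_cases hi : i < L
  · rw [h i hi]
    by_cases hin : i = n <;> simp [hin]
  · rw [digit_eq_zero hv' (not_lt.1 hi), Function.update_of_ne (by omega),
      digit_eq_zero hv (not_lt.1 hi)]

theorem exists_digit_update {N L v n d : ℕ} (hv : v < N ^ L) (hn : n < L) (hd : d < N) :
    ∃ v' < N ^ L, digit N v' = Function.update (digit N v) n d := by
  refine exists_digit _ (fun i => ?_) (fun i hi => ?_)
  · by_cases hin : i = n
    · simpa [hin]
    · simpa [hin] using digit_lt (by omega) v i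
  · rw [Function.update_of_ne (by omega), digit_eq_zero hv hi]

/-! ## Fair paths -/

/-- The states from which `p` can be reached in `n` steps. -/
def ReachIn {α : Type} (r : α → α → Prop) (p : α → Prop) : ℕ → α → Prop
  | 0, t => p t
  | n + 1, t => ∃ t', r t t' ∧ ReachIn r p n t'

theorem exists_reachIn {α : Type} {r : α → α → Prop} {p : α → Prop} {t t' : α}
    (h : Relation.ReflTransGen r t t') (hp : p t') : ∃ n, ReachIn r p n t := by
  induction h using Relation.ReflTransGen.head_induction_on with
  | refl => exact ⟨0, hp⟩
  | head h _ ih =>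
    obtain ⟨n, hn⟩ := ih
    exact ⟨n + 1, _, h, hn⟩

/-- A scheduler: the state is paired with a counter `m`, and `m.unpair.1` is the current obligation.
While it is pending, the path moves closer to a state where it is not; then the counter increases.
Every `e` is the first component of arbitrarily large counters, hence is served infinitely often. -/
theorem exists_fair_path {α : Type} {r : α → α → Prop} (serial : ∀ t, ∃ t', r t t')
    {pend : ℕ → α → Prop} (reach : ∀ e t, ∃ t', Relation.ReflTransGen r t t' ∧ ¬ pend e t')
    (t₀ : α) : ∃ ρ : ℕ → α, ρ 0 = t₀ ∧ (∀ i, r (ρ i) (ρ (i + 1))) ∧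
      ∀ e i, ∃ j ≥ i, ¬ pend e (ρ j) := by
  classical
  have hreach (e : ℕ) (t : α) : ∃ n, ReachIn r (fun t => ¬ pend e t) n t := by
    obtain ⟨t', h, h'⟩ := reach e t
    exact exists_reachIn h h'
  have hrank (e : ℕ) (t : α) (h : pend e t) :
      ∃ t', r t t' ∧ Nat.find (hreach e t') < Nat.find (hreach e t) := by
    have hs := Nat.find_spec (hreach e t)
    cases hn : Nat.find (hreach e t) with
    | zero =>
      rw [hn] at hs
      exact (hs h).elim
    | succ n =>
      rw [hn] at hs
      obtain ⟨t', h1, h2⟩ := hs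
      exact ⟨t', h1, Nat.lt_succ_of_le (Nat.find_min' _ h2)⟩
  choose succ hsucc using serial
  choose! step hstep hlt using hrank
  let next : α × ℕ → α × ℕ := fun p =>
    if pend p.2.unpair.1 p.1 then (step p.2.unpair.1 p.1, p.2) else (succ p.1, p.2 + 1)
  let path : ℕ → α × ℕ := fun i => next^[i] (t₀, 0)
  have hpath (i : ℕ) : path (i + 1) = next (path i) := Function.iterate_succ_apply' _ _ _
  -- By induction on the distance to a state that discharges the current obligation.
  have hfin (n : ℕ) : ∀ i, Nat.find (hreach (path i).2.unpair.1 (path i).1) ≤ n →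
      ∃ j ≥ i, (path j).2 = (path i).2 ∧ ¬ pend (path i).2.unpair.1 (path j).1 := by
    induction n with
    | zero =>
      intro i hi
      refine ⟨i, le_rfl, rfl, fun h => ?_⟩
      have := hlt _ _ h
      omega
    | succ n ih =>
      intro i hi
      by_cases h : pend (path i).2.unpair.1 (path i).1
      · have e : path (i + 1) = (step (path i).2.unpair.1 (path i).1, (path i).2) := by
          rw [hpath]
          exact if_pos h
        have hl := hlt _ _ h
        obtain ⟨j, hj, h1, h2⟩ := ih (i + 1) (by rw [e]; dsimp only; omega)
        rw [e] at h1 h2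
        exact ⟨j, by omega, h1, h2⟩
      · exact ⟨i, le_rfl, rfl, h⟩
  have hall (i m : ℕ) (hm : (path i).2 ≤ m) :
      ∃ j ≥ i, (path j).2 = m ∧ ¬ pend m.unpair.1 (path j).1 := by
    induction m, hm using Nat.le_induction with
    | base => exact hfin _ i le_rfl
    | succ m _ ih =>
      obtain ⟨j, hj, h1, h2⟩ := ih
      have e : path (j + 1) = (succ (path j).1, m + 1) := by
        rw [hpath]
        simp only [next, h1, if_neg h2]
      obtain ⟨j', hj', h1', h2'⟩ := hfin _ (j + 1) le_rfl
      rw [e] at h1' h2'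
      exact ⟨j', by omega, h1', h2'⟩
  refine ⟨fun i => (path i).1, rfl, fun i => ?_, fun e i => ?_⟩
  · dsimp only
    rw [hpath]
    by_cases h : pend (path i).2.unpair.1 (path i).1
    · simp only [next, if_pos h, hstep _ _ h]
    · simp only [next, if_neg h, hsucc]
  -- This counter value serves `e` and is not yet passed at time `i`.
  · obtain ⟨j, hj, -, h⟩ := hall i (Nat.pair e (path i).2) (Nat.right_le_pair _ _)
    rw [Nat.unpair_pair] at h
    exact ⟨j, hj, h⟩

/-- The unfolding law alone also allows `U` to hold forever without `B`; the fairness hypothesis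
`hf` excludes exactly this, leaving the least solution. -/
theorem until_iff {A B U : ℕ → Prop} (hU : ∀ i, U i ↔ B i ∨ (A i ∧ U (i + 1)))
    (hf : ∀ i, ∃ j ≥ i, ¬ (U j ∧ ¬ B j)) (i : ℕ) :
    U i ↔ ∃ j, B (i + j) ∧ ∀ m < j, A (i + m) := by
  constructor
  · obtain ⟨j, hj, h⟩ := hf i
    obtain ⟨n, rfl⟩ := Nat.exists_eq_add_of_le hj
    clear hj
    induction n generalizing i with
    | zero =>
      intro hi
      exact ⟨0, not_not.1 fun hB => h ⟨hi, hB⟩, by simp⟩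
    | succ n ih =>
      intro hi
      rcases (hU i).1 hi with hB | ⟨hA, hi'⟩
      · exact ⟨0, hB, by simp⟩
      · obtain ⟨j, hj, hm⟩ := ih (i + 1) (by rwa [Nat.add_assoc, Nat.add_comm 1]) hi'
        refine ⟨j + 1, by rwa [Nat.add_comm j, ← Nat.add_assoc], fun m hmj => ?_⟩
        cases m with
        | zero => exact hA
        | succ m =>
          rw [Nat.add_comm m, ← Nat.add_assoc]
          exact hm m (by omega)
  · rintro ⟨j, hj, hm⟩
    induction j generalizing i with
    | zero => exact (hU i).2 (Or.inl hj)
    | succ j ih =>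
      refine (hU i).2 (Or.inr ⟨hm 0 (by omega), ih (i + 1) ?_ fun m hmj => ?_⟩)
      · rwa [Nat.add_assoc, Nat.add_comm 1]
      · rw [Nat.add_assoc, Nat.add_comm 1]
        exact hm (m + 1) (by omega)

theorem until_unfold (A B : ℕ → Prop) (i : ℕ) :
    (∃ j, B (i + j) ∧ ∀ m < j, A (i + m)) ↔
      B i ∨ (A i ∧ ∃ j, B (i + 1 + j) ∧ ∀ m < j, A (i + 1 + m)) := by
  constructor
  · rintro ⟨j, hj, hm⟩
    cases j with
    | zero => exact Or.inl hj
    | succ j =>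
      refine Or.inr ⟨hm 0 (by omega), j, by rwa [Nat.add_assoc, Nat.add_comm 1], fun m hmj => ?_⟩
      rw [Nat.add_assoc, Nat.add_comm 1]
      exact hm (m + 1) (by omega)
  · rintro (hB | ⟨hA, j, hj, hm⟩)
    · exact ⟨0, hB, by simp⟩
    · refine ⟨j + 1, by rwa [Nat.add_comm j, ← Nat.add_assoc], fun m hmj => ?_⟩
      cases m with
      | zero => exact hA
      | succ m =>
        rw [Nat.add_comm m, ← Nat.add_assoc]
        exact hm m (by omega)

/-! ## Certificates of satisfiability -/

theorem ite_iff_ite {p a b c d : Prop} [Decidable p] (h : p → (a ↔ b)) (h' : ¬ p → (c ↔ d)) :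
    (if p then a else c) ↔ (if p then b else d) := by
  by_cases hp : p
  · simpa only [if_pos hp] using h hp
  · simpa only [if_neg hp] using h' hp

/-- Recursive calls occur only under tags at least 1, hence at smaller codes, so the termination
guard can be dropped. This covers all numbers, not only codes of formulas. -/
theorem codeHolds_iff {z k : ℕ → ℕ} {ar : ℕ → List ℕ} {P : ℕ → ℕ → List ℕ → Prop}
    {c i : ℕ} {w : ℕ → ℕ} :
    CodeHolds z k ar P c i w ↔ codeHoldsBody z k ar P c (CodeHolds z k ar P) i w := by
  have h1 {m : ℕ} (h : c.unpair.1 = m + 1) : c.unpair.2 < c := by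
    conv_rhs => rw [← Nat.pair_unpair c]
    exact lt_pair_right (by omega) _
  have hl {m : ℕ} (h : c.unpair.1 = m + 1) : c.unpair.2.unpair.1 < c :=
    (Nat.unpair_left_le _).trans_lt (h1 h)
  have hr {m : ℕ} (h : c.unpair.1 = m + 1) : c.unpair.2.unpair.2 < c :=
    (Nat.unpair_right_le _).trans_lt (h1 h)
  rw [CodeHolds]
  unfold codeHoldsBody
  refine ite_iff_ite (fun h => .rfl) fun _ => ite_iff_ite (fun h => .rfl) fun _ =>
    ite_iff_ite (fun h => ?_) fun _ => ite_iff_ite (fun h => ?_) fun _ =>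
    ite_iff_ite (fun h => ?_) fun _ => ite_iff_ite (fun h => ?_) fun _ =>
    ite_iff_ite (fun h => ?_) fun _ => ite_iff_ite (fun h => ?_) fun _ =>
    ite_iff_ite (fun h => ?_) fun _ => ite_iff_ite (fun h => ?_) fun _ => .rfl
  all_goals simp only [h1 h, hl h, hr h, dite_true]

section Untl

variable {z k : ℕ → ℕ} {ar : ℕ → List ℕ} {P : ℕ → ℕ → List ℕ → Prop} {c i : ℕ} {w : ℕ → ℕ}

theorem codeHolds_rel (h : c.unpair.1 = 2) : CodeHolds z k ar P c i w ↔
    P i c.unpair.2.unpair.1 (termsValue z k w (ar c.unpair.2.unpair.1)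
      (decodeD [] c.unpair.2.unpair.2)) := by
  rw [codeHolds_iff]
  simp only [codeHoldsBody, h, OfNat.ofNat_ne_one, if_false, if_true]

theorem codeHolds_untl (h : c.unpair.1 = 9) : CodeHolds z k ar P c i w ↔
    ∃ j, CodeHolds z k ar P c.unpair.2.unpair.2 (i + j) w ∧
      ∀ m < j, CodeHolds z k ar P c.unpair.2.unpair.1 (i + m) w := by
  rw [codeHolds_iff]
  simp only [codeHoldsBody, h, OfNat.ofNat_ne_one, Nat.reduceEqDiff, if_false, if_true]

theorem codeHolds_release (h : c.unpair.1 = 10) : CodeHolds z k ar P c i w ↔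
    ¬ ∃ j, ¬ CodeHolds z k ar P c.unpair.2.unpair.2 (i + j) w ∧
      ∀ m < j, ¬ CodeHolds z k ar P c.unpair.2.unpair.1 (i + m) w := by
  rw [codeHolds_iff]
  simp only [codeHoldsBody, h, OfNat.ofNat_ne_one, Nat.reduceEqDiff, if_false, if_true]

end Untl

/-- What the type `t` at some time and the type `t'` at the next time say about the formula `c`
under the valuation `v`, in terms of its subformulas. A type `t` is the set of the pairs of a
formula code and a valuation that hold. Codes are less than `M`, valuations are functions from
`{0, …, L - 1}` to `{0, …, N - 1}`. -/
def typeBody (M N L z k : ℕ) (ar : List (List ℕ)) (t t' c v : ℕ) : Prop :=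
  if c.unpair.1 = 1 then
    termValue (digit N z) (digit N k) (digit N v) c.unpair.2.unpair.1 c.unpair.2.unpair.2.unpair.1 =
      termValue (digit N z) (digit N k) (digit N v) c.unpair.2.unpair.1
        c.unpair.2.unpair.2.unpair.2
  else if c.unpair.1 = 2 then
    -- Atoms with the same relation and the same argument values must agree, so that a type
    -- determines an interpretation of the relations.
    BEx M fun c' => BEx (N ^ L) fun v' => c'.unpair.1 = 2 ∧
      c'.unpair.2.unpair.1 = c.unpair.2.unpair.1 ∧
      termsValue (digit N z) (digit N k) (digit N v') (ar.getD c'.unpair.2.unpair.1 [])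
          (decodeD [] c'.unpair.2.unpair.2) =
        termsValue (digit N z) (digit N k) (digit N v) (ar.getD c.unpair.2.unpair.1 [])
          (decodeD [] c.unpair.2.unpair.2) ∧ Bit t (Nat.pair c' v')
  else if c.unpair.1 = 3 then ¬ Bit t (Nat.pair c.unpair.2 v)
  else if c.unpair.1 = 4 then
    Bit t (Nat.pair c.unpair.2.unpair.1 v) ∨ Bit t (Nat.pair c.unpair.2.unpair.2 v)
  else if c.unpair.1 = 5 then
    Bit t (Nat.pair c.unpair.2.unpair.1 v) ∧ Bit t (Nat.pair c.unpair.2.unpair.2 v)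
  else if c.unpair.1 = 6 then
    BEx (digit N z c.unpair.2.unpair.1.unpair.1 + 1) fun d => BEx (N ^ L) fun v' =>
      (BAll L fun i => digit N v' i = if i = c.unpair.2.unpair.1 then d else digit N v i) ∧
      Bit t (Nat.pair c.unpair.2.unpair.2 v')
  else if c.unpair.1 = 7 then
    BAll (digit N z c.unpair.2.unpair.1.unpair.1 + 1) fun d => BEx (N ^ L) fun v' =>
      (BAll L fun i => digit N v' i = if i = c.unpair.2.unpair.1 then d else digit N v i) ∧
      Bit t (Nat.pair c.unpair.2.unpair.2 v')
  else if c.unpair.1 = 8 then Bit t' (Nat.pair c.unpair.2 v)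
  else if c.unpair.1 = 9 then
    Bit t (Nat.pair c.unpair.2.unpair.2 v) ∨
      (Bit t (Nat.pair c.unpair.2.unpair.1 v) ∧ Bit t' (Nat.pair c v))
  else if c.unpair.1 = 10 then
    Bit t (Nat.pair c.unpair.2.unpair.2 v) ∧
      (Bit t (Nat.pair c.unpair.2.unpair.1 v) ∨ Bit t' (Nat.pair c v))
  else False

theorem typeBody_untl {M N L z k : ℕ} {ar : List (List ℕ)} {t t' c v : ℕ} (h : c.unpair.1 = 9) :
    typeBody M N L z k ar t t' c v ↔ Bit t (Nat.pair c.unpair.2.unpair.2 v) ∨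
      (Bit t (Nat.pair c.unpair.2.unpair.1 v) ∧ Bit t' (Nat.pair c v)) := by
  simp only [typeBody, h, OfNat.ofNat_ne_one, Nat.reduceEqDiff, if_false, if_true]

theorem typeBody_release {M N L z k : ℕ} {ar : List (List ℕ)} {t t' c v : ℕ}
    (h : c.unpair.1 = 10) :
    typeBody M N L z k ar t t' c v ↔ Bit t (Nat.pair c.unpair.2.unpair.2 v) ∧
      (Bit t (Nat.pair c.unpair.2.unpair.1 v) ∨ Bit t' (Nat.pair c v)) := by
  simp only [typeBody, h, OfNat.ofNat_ne_one, Nat.reduceEqDiff, if_false, if_true]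

/-- The type `t'` can follow the type `t`. -/
def IsStep (M N L z k : ℕ) (ar : List (List ℕ)) (t t' : ℕ) : Prop :=
  BAll M fun c => BAll (N ^ L) fun v =>
    (Bit t (Nat.pair c v) ↔ typeBody M N L z k ar t t' c v)

/-- The type `t` postpones the fulfilment of an until formula or the violation of a release
formula. -/
def IsPending (t c v : ℕ) : Prop :=
  (c.unpair.1 = 9 ∧ Bit t (Nat.pair c v) ∧ ¬ Bit t (Nat.pair c.unpair.2.unpair.2 v)) ∨
    (c.unpair.1 = 10 ∧ ¬ Bit t (Nat.pair c v) ∧ Bit t (Nat.pair c.unpair.2.unpair.2 v))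

/-- `g` is a set of types from which a model of the formula `θ` can be built: one of its types
contains `θ`, every type has a successor in `g`, and one can leave every set `C` of types of `g`
that postpone the same formula. -/
def IsCertificate (M N L z k : ℕ) (ar : List (List ℕ)) (θ g : ℕ) : Prop :=
  (BEx (2 ^ Nat.pair M (N ^ L)) fun t => Bit g t ∧ BEx (N ^ L) fun v => Bit t (Nat.pair θ v)) ∧
  (BAll (2 ^ Nat.pair M (N ^ L)) fun t => ¬ Bit g t ∨
    BEx (2 ^ Nat.pair M (N ^ L)) fun t' => Bit g t' ∧ IsStep M N L z k ar t t') ∧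
  -- Reachability is replaced by a bounded quantifier over sets: `C` is empty, or it does not
  -- consist of pending types of `g`, or some step leads from `C` to a type of `g` outside `C`.
  BAll M fun c => BAll (N ^ L) fun v => BAll (2 ^ 2 ^ Nat.pair M (N ^ L)) fun C =>
    (¬ BEx (2 ^ Nat.pair M (N ^ L)) fun t => Bit C t) ∨
    (¬ BAll (2 ^ Nat.pair M (N ^ L)) fun t => ¬ Bit C t ∨ (Bit g t ∧ IsPending t c v)) ∨
    BEx (2 ^ Nat.pair M (N ^ L)) fun t => Bit C t ∧
      BEx (2 ^ Nat.pair M (N ^ L)) fun t' => Bit g t' ∧ ¬ Bit C t' ∧ IsStep M N L z k ar t t'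

theorem unpair_lt_pair {c M : ℕ} (hc : c < M) :
    c.unpair.2 < M ∧ c.unpair.2.unpair.1 < M ∧ c.unpair.2.unpair.2 < M := by
  have h1 := Nat.unpair_right_le c
  have h2 := Nat.unpair_left_le c.unpair.2
  have h3 := Nat.unpair_right_le c.unpair.2
  omega

theorem lt_pair_self_of_lt {c M : ℕ} (hc : c < M) : c < Nat.pair M M :=
  hc.trans_le (Nat.left_le_pair _ _)

/-- The quantifier steps of `typeBody`. -/
theorem bEx_update_iff {N L v n d : ℕ} (hv : v < N ^ L) (hn : n < L) (hd : d < N) {p : ℕ → Prop}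
    {q : (ℕ → ℕ) → Prop} (hpq : ∀ v' < N ^ L, p v' ↔ q (digit N v')) :
    (BEx (N ^ L) fun v' => (BAll L fun i => digit N v' i = if i = n then d else digit N v i) ∧ p v')
      ↔ q (Function.update (digit N v) n d) := by
  constructor
  · rintro ⟨v', hv', h, hp⟩
    rw [← digit_eq_update hv hv' hn h]
    exact (hpq v' hv').1 hp
  · intro h
    obtain ⟨v', hv', e⟩ := exists_digit_update hv hn hd
    refine ⟨v', hv', fun i _ => ?_, (hpq v' hv').2 (by rwa [e])⟩
    simp only [e, Function.update_apply]

/-- A fair path through the certificate is read as a model. Local consistency gives the truth lemma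
`key` by induction on the code; fairness is used at until and release only. -/
theorem IsCertificate.exists_codeHolds {M N L z k : ℕ} {ar : List (List ℕ)} {θ g : ℕ}
    (hN : 0 < N) (hL : L = Nat.pair M M) (hθ : θ < M) (h : IsCertificate M N L z k ar θ g) :
    ∃ (P : ℕ → ℕ → List ℕ → Prop) (w : ℕ → ℕ),
      CodeHolds (digit N z) (digit N k) (fun R => ar.getD R []) P θ 0 w := by
  obtain ⟨⟨t₀, ht₀, hgt₀, v₀, hv₀, hθv₀⟩, hserial, htrap⟩ := h
  let T := {t : ℕ // t < 2 ^ Nat.pair M (N ^ L) ∧ Bit g t}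
  let r : T → T → Prop := fun t t' => IsStep M N L z k ar t.1 t'.1
  have serial (t : T) : ∃ t', r t t' := by
    rcases hserial t.1 t.2.1 with h | ⟨t', ht', hgt', h⟩
    · exact (h t.2.2).elim
    · exact ⟨⟨t', ht', hgt'⟩, h⟩
  have reach (e : ℕ) (t : T) : ∃ t', Relation.ReflTransGen r t t' ∧
      ¬ (e.unpair.1 < M ∧ e.unpair.2 < N ^ L ∧ IsPending t'.1 e.unpair.1 e.unpair.2) := by
    -- Otherwise the set of types reachable from `t` is non-empty, consists of pending types and is
    -- closed under steps, contrary to the last clause of the certificate.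
    by_contra! hcon
    obtain ⟨C, hC, hCt⟩ := exists_bit (L := 2 ^ Nat.pair M (N ^ L))
      (fun n => ∃ t' : T, t'.1 = n ∧ Relation.ReflTransGen r t t') (by
        rintro n ⟨t', rfl, -⟩
        exact t'.2.1)
    obtain ⟨hc, hv, -⟩ := hcon t .refl
    rcases htrap _ hc _ hv C hC with h | h | ⟨u, _, hu, u', hu', hgu', hCu', hs⟩
    · exact h ⟨t.1, t.2.1, (hCt _).2 ⟨t, rfl, .refl⟩⟩
    · refine h fun n _ => or_iff_not_imp_left.2 fun hn => ?_
      obtain ⟨t', rfl, ht'⟩ := (hCt n).1 (not_not.1 hn)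
      exact ⟨t'.2.2, (hcon t' ht').2.2⟩
    · obtain ⟨t', rfl, ht'⟩ := (hCt u).1 hu
      exact hCu' ((hCt u').2 ⟨⟨u', hu', hgu'⟩, rfl, ht'.tail hs⟩)
  obtain ⟨ρ, hρ0, hρ, hfair⟩ := exists_fair_path serial reach ⟨t₀, ht₀, hgt₀⟩
  let P : ℕ → ℕ → List ℕ → Prop := fun i R l => BEx M fun c' => BEx (N ^ L) fun v' =>
    c'.unpair.1 = 2 ∧ c'.unpair.2.unpair.1 = R ∧
      termsValue (digit N z) (digit N k) (digit N v') (ar.getD c'.unpair.2.unpair.1 [])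
          (decodeD [] c'.unpair.2.unpair.2) = l ∧ Bit (ρ i).1 (Nat.pair c' v')
  have key (c : ℕ) : c < M → ∀ i, ∀ v < N ^ L,
      (CodeHolds (digit N z) (digit N k) (fun R => ar.getD R []) P c i (digit N v) ↔
        Bit (ρ i).1 (Nat.pair c v)) := by
    induction c using Nat.strong_induction_on with
    | _ c ih =>
    intro hc i v hv
    have hlt {m : ℕ} (h : c.unpair.1 = m + 1) : c.unpair.2 < c := by
      conv_rhs => rw [← Nat.pair_unpair c]
      exact lt_pair_right (h ▸ Nat.le_add_left _ _) _
    have ih0 {m : ℕ} (h : c.unpair.1 = m + 1) := ih c.unpair.2 (hlt h) (unpair_lt_pair hc).1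
    have ih1 {m : ℕ} (h : c.unpair.1 = m + 1) := ih c.unpair.2.unpair.1
      ((Nat.unpair_left_le _).trans_lt (hlt h)) (unpair_lt_pair hc).2.1
    have ih2 {m : ℕ} (h : c.unpair.1 = m + 1) := ih c.unpair.2.unpair.2
      ((Nat.unpair_right_le _).trans_lt (hlt h)) (unpair_lt_pair hc).2.2
    have hs (i : ℕ) : Bit (ρ i).1 (Nat.pair c v) ↔
      typeBody M N L z k ar (ρ i).1 (ρ (i + 1)).1 c v := hρ i c hc v hv
    have hd {s d : ℕ} (hd : d < digit N z s + 1) : d < N :=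
      (Nat.lt_succ_iff.1 hd).trans_lt (digit_lt hN z s)
    by_cases h9 : c.unpair.1 = 9
    · simp only [typeBody_untl h9] at hs
      rw [codeHolds_untl h9]
      simp only [ih1 h9 _ v hv, ih2 h9 _ v hv]
      refine (until_iff (U := fun i => Bit (ρ i).1 (Nat.pair c v)) hs (fun i => ?_) i).symm
      obtain ⟨j, hj, hp⟩ := hfair (Nat.pair c v) i
      rw [Nat.unpair_pair] at hp
      exact ⟨j, hj, fun h => hp ⟨hc, hv, Or.inl ⟨h9, h⟩⟩⟩
    by_cases h10 : c.unpair.1 = 10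
    · simp only [typeBody_release h10] at hs
      rw [codeHolds_release h10]
      simp only [ih1 h10 _ v hv, ih2 h10 _ v hv]
      -- A failing release is an until of the negations, so `until_iff` applies to the complements.
      rw [← not_iff_not, not_not]
      refine (until_iff (U := fun i => ¬ Bit (ρ i).1 (Nat.pair c v))
        (A := fun i => ¬ Bit (ρ i).1 (Nat.pair c.unpair.2.unpair.1 v))
        (B := fun i => ¬ Bit (ρ i).1 (Nat.pair c.unpair.2.unpair.2 v))
        (fun i => ?_) (fun i => ?_) i).symm
      · rw [hs i, not_and_or, not_or]
      · obtain ⟨j, hj, hp⟩ := hfair (Nat.pair c v) i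
        rw [Nat.unpair_pair] at hp
        exact ⟨j, hj, fun h => hp ⟨hc, hv, Or.inr ⟨h10, h.1, not_not.1 h.2⟩⟩⟩
    rw [codeHolds_iff, hs i]
    unfold codeHoldsBody typeBody
    refine ite_iff_ite (fun h => .rfl) fun _ => ite_iff_ite (fun h => .rfl) fun _ =>
      ite_iff_ite (fun h => ?_) fun _ => ite_iff_ite (fun h => ?_) fun _ =>
      ite_iff_ite (fun h => ?_) fun _ => ite_iff_ite (fun h => ?_) fun _ =>
      ite_iff_ite (fun h => ?_) fun _ => ite_iff_ite (fun h => ?_) fun _ =>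
      ite_iff_ite (fun h => absurd h h9) fun _ => ite_iff_ite (fun h => absurd h h10) fun _ => .rfl
    · rw [ih0 h i v hv]
    · rw [ih1 h i v hv, ih2 h i v hv]
    · rw [ih1 h i v hv, ih2 h i v hv]
    · refine exists_congr fun d => and_congr_right fun hdz => ?_
      exact (bEx_update_iff hv (hL ▸ lt_pair_self_of_lt (unpair_lt_pair hc).2.1) (hd hdz)
        (fun v' hv' => (ih2 h i v' hv').symm)).symm
    · refine forall₂_congr fun d hdz => ?_
      exact (bEx_update_iff hv (hL ▸ lt_pair_self_of_lt (unpair_lt_pair hc).2.1) (hd hdz)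
        (fun v' hv' => (ih2 h i v' hv').symm)).symm
    · exact ih0 h (i + 1) v hv
  exact ⟨P, digit N v₀, (key θ hθ 0 v₀ hv₀).2 (by rwa [hρ0])⟩

/-- The type at a time is the set of pairs that hold there, and `g` collects the types that occur
along the model. -/
theorem exists_isCertificate {M N L θ : ℕ} {ar : List (List ℕ)} {z k w : ℕ → ℕ}
    {P : ℕ → ℕ → List ℕ → Prop} (hN : 0 < N) (hL : L = Nat.pair M M) (hθ : θ < M)
    (hzN : ∀ n, z n < N) (hzM : ∀ n ≥ M, z n = 0) (hkN : ∀ n, k n < N) (hkM : ∀ n ≥ M, k n = 0)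
    (hwN : ∀ n, w n < N) (hwL : ∀ n ≥ L, w n = 0)
    (h : CodeHolds z k (fun R => ar.getD R []) P θ 0 w) :
    ∃ z' < N ^ M, ∃ k' < N ^ M, ∃ g < 2 ^ 2 ^ Nat.pair M (N ^ L),
      IsCertificate M N L z' k' ar θ g := by
  obtain ⟨z', hz', rfl⟩ := exists_digit z hzN hzM
  obtain ⟨k', hk', rfl⟩ := exists_digit k hkN hkM
  obtain ⟨v₀, hv₀, rfl⟩ := exists_digit w hwN hwL
  have htypes (i : ℕ) := exists_bit (L := Nat.pair M (N ^ L))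
    (fun n => n.unpair.1 < M ∧ n.unpair.2 < N ^ L ∧ CodeHolds (digit N z') (digit N k')
      (fun R => ar.getD R []) P n.unpair.1 i (digit N n.unpair.2)) (fun n hn => by
      have h1 := Nat.pair_lt_pair_left n.unpair.2 hn.1
      have h2 := Nat.pair_lt_pair_right M hn.2.1
      rw [Nat.pair_unpair] at h1
      omega)
  choose ρ hρ hbit using htypes
  have key {c : ℕ} (hc : c < M) {v : ℕ} (hv : v < N ^ L) (i : ℕ) : Bit (ρ i) (Nat.pair c v) ↔
      CodeHolds (digit N z') (digit N k') (fun R => ar.getD R []) P c i (digit N v) := by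
    rw [hbit, Nat.unpair_pair]
    exact ⟨fun h => h.2.2, fun h => ⟨hc, hv, h⟩⟩
  obtain ⟨g, hg, hgt⟩ := exists_bit (L := 2 ^ Nat.pair M (N ^ L)) (fun n => ∃ i, ρ i = n)
    (by rintro n ⟨i, rfl⟩; exact hρ i)
  have hstep (i : ℕ) : IsStep M N L z' k' ar (ρ i) (ρ (i + 1)) := by
    intro c hc v hv
    have hd {s d : ℕ} (hd : d < digit N z' s + 1) : d < N :=
      (Nat.lt_succ_iff.1 hd).trans_lt (digit_lt hN z' s)
    obtain ⟨c0, c1, c2⟩ := unpair_lt_pair hc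
    by_cases h9 : c.unpair.1 = 9
    · rw [typeBody_untl h9, key hc hv, key c2 hv, key c1 hv, key hc hv, codeHolds_untl h9,
        codeHolds_untl h9]
      exact until_unfold (fun i => CodeHolds _ _ _ P _ i _) (fun i => CodeHolds _ _ _ P _ i _) i
    by_cases h10 : c.unpair.1 = 10
    · rw [typeBody_release h10, key hc hv, key c2 hv, key c1 hv, key hc hv, codeHolds_release h10,
        codeHolds_release h10]
      rw [until_unfold (fun i => ¬ CodeHolds _ _ _ P _ i _) (fun i => ¬ CodeHolds _ _ _ P _ i _) i,
        not_or, not_and_or, not_not, not_not]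
    rw [key hc hv, codeHolds_iff]
    unfold codeHoldsBody typeBody
    refine ite_iff_ite (fun h => .rfl) fun _ => ite_iff_ite (fun h => ?_) fun _ =>
      ite_iff_ite (fun h => ?_) fun _ => ite_iff_ite (fun h => ?_) fun _ =>
      ite_iff_ite (fun h => ?_) fun _ => ite_iff_ite (fun h => ?_) fun _ =>
      ite_iff_ite (fun h => ?_) fun _ => ite_iff_ite (fun h => ?_) fun _ =>
      ite_iff_ite (fun h => absurd h h9) fun _ => ite_iff_ite (fun h => absurd h h10) fun _ => .rfl
    · constructor
      · exact fun hP => ⟨c, hc, v, hv, h, rfl, rfl, (key hc hv i).2 ((codeHolds_rel h).2 hP)⟩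
      · rintro ⟨c', hc', v', hv', h', e1, e2, hb⟩
        rw [key hc' hv', codeHolds_rel h'] at hb
        rwa [e2, e1] at hb
    · rw [key c0 hv]
    · rw [key c1 hv, key c2 hv]
    · rw [key c1 hv, key c2 hv]
    · refine exists_congr fun d => and_congr_right fun hdz => ?_
      exact (bEx_update_iff hv (hL ▸ lt_pair_self_of_lt c1) (hd hdz)
        (fun v' hv' => key c2 hv' i)).symm
    · refine forall₂_congr fun d hdz => ?_
      exact (bEx_update_iff hv (hL ▸ lt_pair_self_of_lt c1) (hd hdz)
        (fun v' hv' => key c2 hv' i)).symm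
    · rw [key c0 hv]
  refine ⟨z', hz', k', hk', g, hg, ⟨ρ 0, hρ 0, (hgt _).2 ⟨0, rfl⟩, v₀, hv₀, (key hθ hv₀ 0).2 h⟩,
    fun t _ => or_iff_not_imp_left.2 fun ht => ?_, fun c hc v hv C hC => ?_⟩
  · obtain ⟨i, rfl⟩ := (hgt t).1 (not_not.1 ht)
    exact ⟨ρ (i + 1), hρ _, (hgt _).2 ⟨_, rfl⟩, hstep i⟩
  · beta_reduce
    rw [or_iff_not_imp_left, or_iff_not_imp_left, not_not, not_not]
    rintro ⟨t, ht, hCt⟩ hall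
    have hsub (n : ℕ) (hn : n < 2 ^ Nat.pair M (N ^ L)) (hCn : Bit C n) :
        Bit g n ∧ IsPending n c v := (hall n hn).resolve_left (not_not.2 hCn)
    obtain ⟨i, rfl⟩ := (hgt t).1 (hsub t ht hCt).1
    obtain ⟨c0, c1, c2⟩ := unpair_lt_pair hc
    -- If the path stayed in `C`, the formula would be pending forever; but at the time that fulfils
    -- the until, or violates the release, it is not pending.
    have hev : ∃ j, ¬ Bit C (ρ (i + j)) := by
      by_contra! hcon
      have hp (j : ℕ) : IsPending (ρ (i + j)) c v := (hsub _ (hρ _) (hcon j)).2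
      rcases hp 0 with ⟨h9, h1, -⟩ | ⟨h10, h1, -⟩
      · rw [key hc hv, codeHolds_untl h9] at h1
        obtain ⟨j, hj, -⟩ := h1
        rw [Nat.add_zero, ← key c2 hv] at hj
        rcases hp j with ⟨-, -, h3⟩ | ⟨h3, -⟩
        · exact h3 hj
        · exact absurd (h9.symm.trans h3) (by norm_num)
      · rw [key hc hv, codeHolds_release h10, not_not] at h1
        obtain ⟨j, hj, -⟩ := h1
        rw [Nat.add_zero, ← key c2 hv] at hj
        rcases hp j with ⟨h3, -⟩ | ⟨-, -, h3⟩
        · exact absurd (h10.symm.trans h3) (by norm_num)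
        · exact hj h3
    classical
    -- The first time outside `C` is not the starting time, so the step just before it leaves `C`.
    obtain ⟨j, hj⟩ : ∃ j, Nat.find hev = j + 1 := by
      refine Nat.exists_eq_succ_of_ne_zero fun h0 => ?_
      have := Nat.find_spec hev
      rw [h0] at this
      exact this hCt
    have h1 : Bit C (ρ (i + j)) := not_not.1 (Nat.find_min hev (by omega))
    have h2 := Nat.find_spec hev
    rw [hj] at h2
    exact ⟨_, hρ _, h1, _, hρ _, (hgt _).2 ⟨_, rfl⟩, h2, hstep (i + j)⟩

/-! ## The decision procedure -/

section Primrec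

variable {α : Type} [Primcodable α]

@[fun_prop]
theorem primrec_digit {b v n : α → ℕ} (hb : Primrec b) (hv : Primrec v) (hn : Primrec n) :
    Primrec (fun a => digit (b a) (v a) (n a)) := by
  unfold digit
  fun_prop

@[fun_prop]
theorem primrecPred_bit {t n : α → ℕ} (ht : Primrec t) (hn : Primrec n) :
    PrimrecPred (fun a => Bit (t a) (n a)) := by
  unfold Bit
  fun_prop

@[fun_prop]
theorem primrec_termValue {N z k v s t : α → ℕ} (hN : Primrec N) (hz : Primrec z) (hk : Primrec k)
    (hv : Primrec v) (hs : Primrec s) (ht : Primrec t) :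
    Primrec (fun a => termValue (digit (N a) (z a)) (digit (N a) (k a)) (digit (N a) (v a)) (s a)
      (t a)) := by
  unfold termValue
  fun_prop

@[fun_prop]
theorem primrec_termsValue {N z k v : α → ℕ} {l ts : α → List ℕ} (hN : Primrec N) (hz : Primrec z)
    (hk : Primrec k) (hv : Primrec v) (hl : Primrec l) (hts : Primrec ts) :
    Primrec (fun a => termsValue (digit (N a) (z a)) (digit (N a) (k a)) (digit (N a) (v a)) (l a)
      (ts a)) := by
  unfold termsValue
  fun_prop

@[fun_prop]
theorem primrecPred_typeBody {M N L z k t t' c v : α → ℕ} {ar : α → List (List ℕ)}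
    (hM : Primrec M) (hN : Primrec N) (hL : Primrec L) (hz : Primrec z) (hk : Primrec k)
    (har : Primrec ar) (ht : Primrec t) (ht' : Primrec t') (hc : Primrec c) (hv : Primrec v) :
    PrimrecPred (fun a =>
      typeBody (M a) (N a) (L a) (z a) (k a) (ar a) (t a) (t' a) (c a) (v a)) := by
  unfold typeBody
  fun_prop

@[fun_prop]
theorem primrecPred_isStep {M N L z k t t' : α → ℕ} {ar : α → List (List ℕ)}
    (hM : Primrec M) (hN : Primrec N) (hL : Primrec L) (hz : Primrec z) (hk : Primrec k)
    (har : Primrec ar) (ht : Primrec t) (ht' : Primrec t') :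
    PrimrecPred (fun a => IsStep (M a) (N a) (L a) (z a) (k a) (ar a) (t a) (t' a)) := by
  unfold IsStep
  fun_prop

@[fun_prop]
theorem primrecPred_isPending {t c v : α → ℕ} (ht : Primrec t) (hc : Primrec c)
    (hv : Primrec v) : PrimrecPred (fun a => IsPending (t a) (c a) (v a)) := by
  unfold IsPending
  fun_prop

@[fun_prop]
theorem primrecPred_isCertificate {M N L z k θ g : α → ℕ} {ar : α → List (List ℕ)}
    (hM : Primrec M) (hN : Primrec N) (hL : Primrec L) (hz : Primrec z) (hk : Primrec k)
    (har : Primrec ar) (hθ : Primrec θ) (hg : Primrec g) :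
    PrimrecPred (fun a =>
      IsCertificate (M a) (N a) (L a) (z a) (k a) (ar a) (θ a) (g a)) := by
  unfold IsCertificate
  fun_prop

end Primrec

/-! ### Correctness of the bounded search -/

/-- There is a certificate for the formula `θ`, with universes of at most `N` elements. -/
def HasCertificate (M N : ℕ) (ar : List (List ℕ)) (θ : ℕ) : Prop :=
  BEx (N ^ M) fun z => BEx (N ^ M) fun k => BEx (2 ^ 2 ^ Nat.pair M (N ^ Nat.pair M M)) fun g =>
    IsCertificate M N (Nat.pair M M) z k ar θ g

/-- The value of `N` is the size bound of `Formula.IsStratified.exists_small`. It matters only for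
finding a certificate; from a given one, a model arises for every positive `N`. -/
theorem Formula.hasCertificate_iff {σ : Signature} [Fintype σ.Con] {φ : Formula σ}
    (h : φ.IsStratified ∅) (hN : φ.IsNNF) {M : ℕ} (hM : φ.code < M)
    (hs : ∀ s : σ.Srt, Encodable.encode s < M) (hc : ∀ c : σ.Con, Encodable.encode c < M)
    (hcard : Fintype.card σ.Con ≤ M) {ar : List (List ℕ)}
    (har : ∀ R, ar.getD (Encodable.encode R) [] = (σ.arity R).map Encodable.encode) :
    HasCertificate M ((2 * M) ^ 2 ^ M) ar φ.code ↔ φ.Satisfiable := by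
  have hpos : 0 < (2 * M) ^ 2 ^ M := Nat.pow_pos (by omega)
  constructor
  · rintro ⟨z, -, k, -, g, -, hg⟩
    obtain ⟨P, w, hP⟩ := hg.exists_codeHolds hpos rfl hM
    exact φ.satisfiable_of_codeHolds har hP
  · rintro ⟨D, τ, ν, hφ⟩
    obtain ⟨ν', S, hν', hcon, hS, hφ'⟩ := h.exists_small hN hM hcard hφ
    obtain ⟨z, k, w, P, h1, h2, h3, h4, h5, h6, h7⟩ :=
      exists_codeHolds (ar := fun R => ar.getD R []) hM hs hc har hν' hcon hS hpos hφ'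
    exact exists_isCertificate hpos rfl hM h1 h2 h3 h4 h5 h6 h7

/-- The codes of the arities of the trace encoding of a signature with code `n`. -/
def traceArities (n : ℕ) : List (List ℕ) :=
  (decodeD ((0, [], []) : ℕ × List ℕ × List (List ℕ)) n).2.2.map
    -- The trace sort, with code 0, comes first; the codes of the old sorts are shifted.
    fun l => 0 :: l.map fun s => s + 1

theorem traceArities_getD (S : FinSignature) (R : Fin S.numRel) :
    (traceArities S.code).getD (Encodable.encode R) [] =
      (S.toSignature.trace.arity R).map Encodable.encode := by
  have h : decodeD ((0, [], []) : ℕ × List ℕ × List (List ℕ)) S.code =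
    (S.lastSort, List.ofFn (fun c => (S.conSort c).val),
      List.ofFn (fun R => (S.arity R).map Fin.val)) := decodeD_encode _ _
  have hR : Encodable.encode R = R.val := rfl
  rw [traceArities, h, hR]
  simp only [List.getD, List.getElem?_map, List.getElem?_ofFn, R.isLt, dite_true, Option.map_some,
    Option.getD_some, List.map_map, List.map_cons]
  rfl

theorem FinSignature.lastSort_le_code (S : FinSignature) : S.lastSort ≤ S.code :=
  Nat.left_le_pair _ _

theorem FinSignature.numCon_le_code (S : FinSignature) : S.numCon ≤ S.code := by
  have h := Encodable.length_le_encode (List.ofFn (fun c => (S.conSort c).val))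
  rw [List.length_ofFn] at h
  exact h.trans ((Nat.left_le_pair _ _).trans (Nat.right_le_pair _ _))

/-- The summand 2 is needed because sort codes of the encoding go up to `S.lastSort + 1`, which must
be less than `M`. -/
theorem HFormula.IsExAllBS.hasCertificate_iff (S : FinSignature) {ψ : HFormula S.toSignature}
    (h : ψ.IsExAllBS) {M : ℕ} (hM : M = S.code + ψ.trace.code + 2) :
    HasCertificate M ((2 * M) ^ 2 ^ M) (traceArities S.code) ψ.trace.code ↔ ψ.Satisfiable := by
  have hl := S.lastSort_le_code
  have hc := S.numCon_le_code
  rw [HFormula.satisfiable_trace]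
  let _ : Fintype S.toSignature.trace.Con := inferInstanceAs (Fintype (Fin S.numCon))
  refine Formula.hasCertificate_iff h.trace.1 h.trace.2 (by omega) (fun s => ?_) (fun c => ?_) ?_
    (fun R => traceArities_getD S R)
  · rcases s with _ | s
    · change 0 < M
      omega
    · change s.val + 1 < M
      have := s.isLt
      omega
  · change Fin.val c < M
    have := Fin.isLt (n := S.numCon) c
    omega
  · change Fintype.card (Fin S.numCon) ≤ M
    have := Fintype.card_fin S.numCon
    omega

end FOLTL

/-- The encoding with a trace sort is a computable translation of HyperFOLTL formulas into
equi-satisfiable FOLTL formulas, which preserves closedness; and there is an algorithm that,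
given a finite signature and a formula of `∃*_π ∀*_π BS-FOLTL` over it, decides whether the
formula is satisfiable. -/
theorem mainTheorem4 :
    (∃ tr : ℕ → ℕ, Computable tr ∧
      ∀ (σ : FOLTL.Signature) (ψ : FOLTL.HFormula σ),
        tr ψ.code = ψ.trace.code ∧
        (ψ.Closed → ψ.trace.Closed) ∧
        (ψ.Satisfiable ↔ ψ.trace.Satisfiable)) ∧
    (∃ dec : ℕ → Bool, Computable dec ∧
      ∀ (S : FOLTL.FinSignature) (ψ : FOLTL.HFormula S.toSignature),
        ψ.IsExAllBS →
          (dec (Nat.pair S.code ψ.code) = true ↔ ψ.Satisfiable)) := by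
  open FOLTL in
  obtain ⟨tr, htr, htrace⟩ := exists_hformulaTrace
  refine ⟨⟨tr, htr.to_comp, fun σ ψ => ⟨htrace σ ψ, HFormula.Closed.trace, ψ.satisfiable_trace⟩⟩,
    ?_⟩
  -- The procedure encodes the formula, computes `M` from the input and searches for a certificate.
  -- It also answers on numbers that code no formula of the fragment, where the answer is
  -- irrelevant.
  obtain ⟨_, hdec⟩ : PrimrecPred fun n : ℕ =>
      HasCertificate (n.unpair.1 + tr n.unpair.2 + 2)
        ((2 * (n.unpair.1 + tr n.unpair.2 + 2)) ^ 2 ^ (n.unpair.1 + tr n.unpair.2 + 2))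
        (traceArities n.unpair.1) (tr n.unpair.2) := by
    unfold HasCertificate traceArities
    fun_prop
  refine ⟨_, hdec.to_comp, fun S ψ hψ => ?_⟩
  beta_reduce
  rw [decide_eq_true_iff, Nat.unpair_pair, htrace]
  exact hψ.hasCertificate_iff S rfl
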